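/- (Davidson's model.) Fix $\theta>0$ and an integer $T\ge 1$, and let $$f(1;y)=\frac{e^{y}}{e^{y}+\theta e^{y/2}+1},\qquad f(0;y)=\frac{\theta e^{y/2}}{e^{y}+\theta e^{y/2}+1},\qquad f(-1;y)=\frac{1}{e^{y}+\theta e^{y/2}+1}.$$ There is a constant $C>0$ depending only on $\theta$ and $T$ such that the following holds. For every $n$ let $p_n\in[0,1]$ and let $\mathbf u=\mathbf u^{(n)}\in\mathbb R^n$ be a score vector with $u_1=0$ and dynamic range $M_n=\max_{i,j}|u_i-u_j|$. For every $n$, let the numbers of comparisons $n_{ij}$, $1\le i<j\le n$, be independent with law $\mathrm{Bin}(T,p_n)$, and, given them, let the outcomes $X_{ij}^{(t)}\in\{-1,0,1\}$ ($1\le t\le n_{ij}$) be independent with $\mathbb P(X_{ij}^{(t)}=x)=f(x;u_i-u_j)$; the data for all $n$ live on one probability space, with an arbitrary joint law across different $n$. Call $\hat{\mathbf u}$ a maximum likelihood estimate (MLE) if it maximizes $$l(\mathbf v)=\sum_{1\le i<j\le n}\ \sum_{t=1}^{n_{ij}}\log f\bigl(X_{ij}^{(t)};v_i-v_j\bigr)$$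 over all $\mathbf v\in\mathbb R^n$ with $v_1=0$. Suppose that there is $c>1$ with $p_n\ge c\,n^{-1}\log n$ for all large $n$, and that $$\Delta_n:=e^{M_n}\sqrt{\frac{\log n}{np_n}}\;\frac{\log n}{\log (np_n)}\longrightarrow 0\qquad(n\to\infty).$$ Then the MLE is a (strongly) uniformly consistent estimator of $\mathbf u$: 1. for all sufficiently large $n$, with probability at least $1-14n^{-2}$, the MLE $\hat{\mathbf u}$ exists, is unique, and satisfies $\|\hat{\mathbf u}-\mathbf u\|_\infty\le C\Delta_n$; 2. almost surely, the MLE exists and is unique for all but finitely many $n$, and $\|\hat{\mathbf u}-\mathbf u\|_\infty\to 0$ as $n\to\infty$. -/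

import Mathlib

open MeasureTheory ProbabilityTheory Filter Topology

noncomputable section

/-- Davidson's link function: the probability of the outcome `x` (`1` win, `0` tie, `-1` loss)
of a comparison with relative score `y`, for the threshold parameter `θ`. -/
def davidson (θ : ℝ) (x : ℤ) (y : ℝ) : ℝ :=
  if x = 1 then Real.exp y / (Real.exp y + θ * Real.exp (y / 2) + 1)
  else if x = 0 then θ * Real.exp (y / 2) / (Real.exp y + θ * Real.exp (y / 2) + 1)
  else if x = -1 then 1 / (Real.exp y + θ * Real.exp (y / 2) + 1)
  else 0

/-- The unordered pairs of distinct subjects, written as ordered pairs `i < j`. -/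
abbrev SubjectPair (n : ℕ) : Type := {e : Fin n × Fin n // e.1 < e.2}

/-- The relative score `v i - v j` of the pair `i < j`. -/
def relScore {n : ℕ} (v : Fin n → ℝ) (e : SubjectPair n) : ℝ := v e.1.1 - v e.1.2

/-- The score vectors whose first coordinate is zero. -/
def normalizedScores (n : ℕ) : Set (Fin n → ℝ) :=
  {v | ∀ i : Fin n, (i : ℕ) = 0 → v i = 0}

/-- The dynamic range `max_{i,j} |u i - u j|`. -/
def dynamicRange {n : ℕ} (u : Fin n → ℝ) : ℝ := ⨆ q : Fin n × Fin n, |u q.1 - u q.2|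

/-- The random comparison data of Davidson's model on `n` subjects with score vector `u`:
`N e` is the number of comparisons of the pair `e`, and `X e t` for `t < N e` are their outcomes.
The counts are independent with law `Bin(T, p)`; the outcomes are independent of each other and of
the counts, the outcome for the pair `i < j` having mass function `davidson θ · (u i - u j)`.
(Outcomes `X e t` with `N e ≤ t` are not observed.) -/
structure IsDavidsonData {Ω : Type*} [MeasurableSpace Ω] (μ : Measure Ω) (θ : ℝ) (T : ℕ)
    (p : unitInterval) {n : ℕ} (u : Fin n → ℝ)
    (N : SubjectPair n → Ω → ℕ) (X : SubjectPair n → Fin T → Ω → ℤ) : Prop where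
  measurable_count : ∀ e, Measurable (N e)
  measurable_outcome : ∀ e t, Measurable (X e t)
  law_count : ∀ e, HasLaw (N e) (ProbabilityTheory.binomial T p) μ
  law_outcome : ∀ e t, ∀ x ∈ ({-1, 0, 1} : Set ℤ),
    μ.real {ω | X e t ω = x} = davidson θ x (relScore u e)
  indep_count : iIndepFun N μ
  indep_outcome : iIndepFun (fun q : SubjectPair n × Fin T => X q.1 q.2) μ
  indep_count_outcome :
    IndepFun (fun ω e => N e ω) (fun ω (q : SubjectPair n × Fin T) => X q.1 q.2 ω) μ

/-- The conditional log-likelihood `∑_{i<j} ∑_{t < N i j} log f(X i j t; v i - v j)` of the score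
vector `v`, given the observed counts `N` and outcomes `X`. -/
def logLikelihood (θ : ℝ) {T n : ℕ} (N : SubjectPair n → ℕ) (X : SubjectPair n → Fin T → ℤ)
    (v : Fin n → ℝ) : ℝ :=
  ∑ e : SubjectPair n, ∑ t ∈ Finset.univ.filter (fun t : Fin T => (t : ℕ) < N e),
    Real.log (davidson θ (X e t) (relScore v e))

/-- `v` is a maximum likelihood estimate: a maximizer of the log-likelihood among all score
vectors whose first coordinate is zero. -/
def IsMLE (θ : ℝ) {T n : ℕ} (N : SubjectPair n → ℕ) (X : SubjectPair n → Fin T → ℤ)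
    (v : Fin n → ℝ) : Prop :=
  v ∈ normalizedScores n ∧ IsMaxOn (logLikelihood θ N X) (normalizedScores n) v

/-- The rate `Δ_n = e^M √(log n / (n p)) · log n / log (n p)`. -/
def davidsonRate (n : ℕ) (p M : ℝ) : ℝ :=
  Real.exp M * √(Real.log n / (n * p)) * (Real.log n / Real.log (n * p))

end

/-! Up to a constant the log-likelihood is a concave function of the score differences
(`log_davidson`), and its gradient at `u` is pure noise. Let `v` maximize it among score vectors for
which `δ = v - u` has spread at most 1. Lowering all scores in an upper level set `U` of `δ` by a
little keeps this constraint, so the derivative in that direction is nonpositive. The curvature on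
the relevant range is at least a multiple of `e^{-M}`, so the sum of `W e * |δ i - δ j|` over the
cut of `U` is at most a multiple of `e^M` times the noise across that cut (`sum_cut_le_of_maximal`).

If the comparison graph expands, a cut sum of order `|U|` forces the level set to grow by a factor
`K` whenever the level drops by a suitable `d`, until it contains more than half of the subjects
(`upperLevel_expands`). This takes about `log n / log K` drops. The same holds from below; the two
majorities meet, so the spread of `δ` is at most `2 m d` (`sub_le_of_level_bounds`). When this is
less than 1 the constraint is inactive, and concavity makes `v` a global maximizer
(`existsUnique_maximizer_of_isExpanding`).

Chernoff bounds and union bounds over vertex sets give expansion with `K = √(np)` and noise at most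
`ε T p n |U|` with `ε = √(3 log n / (np))`, outside an event of probability `14 / n²`
(`IsDavidsonData.measureReal_not_regular_le`). Then `d` is of order `e^M ε` and `m d` of order
`Δ_n`. Borel–Cantelli gives the almost sure statements. -/

noncomputable section

/-! ### Cuts, level sets and expansion -/

/-- The pairs with one subject in `U` and the other one in `V`. -/
def pairsBetween {n : ℕ} (U V : Finset (Fin n)) : Finset (SubjectPair n) :=
  Finset.univ.filter fun e => (e.1.1 ∈ U ∧ e.1.2 ∈ V) ∨ (e.1.2 ∈ U ∧ e.1.1 ∈ V)

/-- The subjects at which `δ` is at least `s`. -/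
def upperLevel {n : ℕ} (δ : Fin n → ℝ) (s : ℝ) : Finset (Fin n) :=
  Finset.univ.filter fun i => s ≤ δ i

theorem mem_pairsBetween {n : ℕ} {U V : Finset (Fin n)} {e : SubjectPair n} :
    e ∈ pairsBetween U V ↔ (e.1.1 ∈ U ∧ e.1.2 ∈ V) ∨ (e.1.2 ∈ U ∧ e.1.1 ∈ V) := by
  simp [pairsBetween]

theorem mem_upperLevel {n : ℕ} {δ : Fin n → ℝ} {s : ℝ} {i : Fin n} :
    i ∈ upperLevel δ s ↔ s ≤ δ i := by
  simp [upperLevel]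

theorem upperLevel_anti {n : ℕ} (δ : Fin n → ℝ) {s t : ℝ} (h : s ≤ t) :
    upperLevel δ t ⊆ upperLevel δ s := fun i hi => by
  rw [mem_upperLevel] at hi ⊢
  exact h.trans hi

theorem pairsBetween_comm {n : ℕ} (U V : Finset (Fin n)) :
    pairsBetween U V = pairsBetween V U := by
  ext e
  simp only [mem_pairsBetween]
  tauto

theorem pairsBetween_mono_right {n : ℕ} (U : Finset (Fin n)) {V V' : Finset (Fin n)}
    (h : V ⊆ V') : pairsBetween U V ⊆ pairsBetween U V' := fun e he => by
  rw [mem_pairsBetween] at he ⊢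
  exact he.imp (fun a => ⟨a.1, h a.2⟩) (fun a => ⟨a.1, h a.2⟩)

theorem card_pairsBetween {n : ℕ} {U V : Finset (Fin n)} (h : Disjoint U V) :
    (pairsBetween U V).card = U.card * V.card := by
  rw [← Finset.card_product]
  have hd : ∀ i, i ∈ U → i ∉ V := fun i hi hi' => Finset.disjoint_left.1 h hi hi'
  refine Finset.card_bij
    (fun e _ => if e.1.1 ∈ U then (e.1.1, e.1.2) else (e.1.2, e.1.1)) ?_ ?_ ?_
  · intro e he
    rw [mem_pairsBetween] at he
    have h1 := hd e.1.1
    split_ifs with h2 <;> simp only [Finset.mem_product] <;> tauto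
  · rintro ⟨⟨a, b⟩, hab⟩ he ⟨⟨a', b'⟩, hab'⟩ he' heq
    rw [mem_pairsBetween] at he he'
    simp only at he he' heq hab hab'
    split_ifs at heq with h1 h2 h2
    · simp_all
    · simp only [Prod.mk.injEq] at heq
      obtain ⟨rfl, rfl⟩ := heq
      exact absurd hab (not_lt.2 hab'.le)
    · simp only [Prod.mk.injEq] at heq
      obtain ⟨rfl, rfl⟩ := heq
      exact absurd hab (not_lt.2 hab'.le)
    · simp_all
  · rintro ⟨a, b⟩ hab
    rw [Finset.mem_product] at hab
    have hne : a ≠ b := fun hh => hd a hab.1 (hh ▸ hab.2)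
    rcases lt_or_gt_of_ne hne with hlt | hlt
    · exact ⟨⟨(a, b), hlt⟩, by rw [mem_pairsBetween]; exact Or.inl hab, by simp [hab.1]⟩
    · have : b ∉ U := fun hb => hd b hb hab.2
      exact ⟨⟨(b, a), hlt⟩, by rw [mem_pairsBetween]; exact Or.inr hab, by simp [this]⟩

/-- `w` gives every small set of subjects, and every moderate enlargement `W` of it, weight at least
`β |U|` on the pairs leaving `W` from `U`. -/
def IsExpanding {n : ℕ} (w : SubjectPair n → ℝ) (K β : ℝ) : Prop :=
  ∀ U W : Finset (Fin n), U ⊆ W → U.Nonempty → (W.card : ℝ) ≤ K * U.card → 2 * W.card ≤ n →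
    β * U.card ≤ ∑ e ∈ pairsBetween U Wᶜ, w e

section Chain

variable {n : ℕ} {w : SubjectPair n → ℝ} {K β γ d : ℝ} {δ : Fin n → ℝ}

/-- Were the lower level set neither `K` times larger nor a majority, expansion would put weight `β
|U|` on pairs that jump over the whole gap `d`, so the cut sum would be at least `β d |U| > γ |U|`.
-/
theorem upperLevel_expands (hw : ∀ e, 0 ≤ w e) (h1 : IsExpanding w K β)
    (h2 : ∀ s, (upperLevel δ s).Nonempty → 2 * (upperLevel δ s).card ≤ n →
      ∑ e ∈ pairsBetween (upperLevel δ s) (upperLevel δ s)ᶜ, w e * |relScore δ e|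
        ≤ γ * (upperLevel δ s).card)
    (hd : 0 < d) (hγ : γ < β * d) {s : ℝ} (hs : (upperLevel δ s).Nonempty) :
    K * (upperLevel δ s).card < (upperLevel δ (s - d)).card ∨
      n < 2 * (upperLevel δ (s - d)).card := by
  by_contra! hcon
  have hsub : upperLevel δ s ⊆ upperLevel δ (s - d) := upperLevel_anti δ (by linarith)
  have hcard := Finset.card_le_card hsub
  have hA := h1 _ _ hsub hs hcon.1 hcon.2
  have hB := h2 s hs (by omega)
  have hC : d * ∑ e ∈ pairsBetween (upperLevel δ s) (upperLevel δ (s - d))ᶜ, w e ≤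
      ∑ e ∈ pairsBetween (upperLevel δ s) (upperLevel δ s)ᶜ, w e * |relScore δ e| := by
    rw [Finset.mul_sum]
    refine (Finset.sum_le_sum fun e he => ?_).trans (Finset.sum_le_sum_of_subset_of_nonneg
      (pairsBetween_mono_right _ (Finset.compl_subset_compl.2 hsub))
      fun e _ _ => mul_nonneg (hw e) (abs_nonneg _))
    rw [mul_comm]
    refine mul_le_mul_of_nonneg_left ?_ (hw e)
    simp only [mem_pairsBetween, Finset.mem_compl, mem_upperLevel, not_le] at he
    rcases he with ⟨ha, hb⟩ | ⟨ha, hb⟩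
    · exact le_trans (by unfold relScore; linarith) (le_abs_self _)
    · exact le_trans (by unfold relScore; linarith) (neg_le_abs _)
  have hpos : (0 : ℝ) < (upperLevel δ s).card := by exact_mod_cast hs.card_pos
  nlinarith

theorem half_lt_card_upperLevel (hw : ∀ e, 0 ≤ w e) (h1 : IsExpanding w K β)
    (h2 : ∀ s, (upperLevel δ s).Nonempty → 2 * (upperLevel δ s).card ≤ n →
      ∑ e ∈ pairsBetween (upperLevel δ s) (upperLevel δ s)ᶜ, w e * |relScore δ e|
        ≤ γ * (upperLevel δ s).card)
    (hd : 0 < d) (hγ : γ < β * d) (hK : 0 ≤ K) (i : Fin n) {m : ℕ} (hm : (n : ℝ) ≤ K ^ m) :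
    n < 2 * (upperLevel δ (δ i - m * d)).card := by
  -- Geometric growth starting from a level set that contains `i`; once a majority is reached,
  -- monotonicity of level sets keeps it.
  have key : ∀ k : ℕ, K ^ k ≤ (upperLevel δ (δ i - k * d)).card ∨
      n < 2 * (upperLevel δ (δ i - k * d)).card := by
    intro k
    induction k with
    | zero =>
      left
      have : 0 < (upperLevel δ (δ i - (0 : ℕ) * d)).card :=
        Finset.card_pos.2 ⟨i, by simp [mem_upperLevel]⟩
      simpa using this
    | succ k ih =>
      have hne : (upperLevel δ (δ i - k * d)).Nonempty :=
        ⟨i, by rw [mem_upperLevel]; nlinarith [Nat.cast_nonneg (α := ℝ) k]⟩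
      have hstep := upperLevel_expands hw h1 h2 hd hγ hne
      have heq : δ i - k * d - d = δ i - (k + 1 : ℕ) * d := by push_cast; ring
      rw [heq] at hstep
      rcases hstep with hs | hs
      · rcases ih with ih | ih
        · left
          rw [pow_succ, mul_comm]
          exact (mul_le_mul_of_nonneg_left ih hK).trans hs.le
        · right
          refine ih.trans_le (Nat.mul_le_mul_left 2 (Finset.card_le_card
            (upperLevel_anti δ ?_)))
          rw [← heq]; linarith
      · exact Or.inr hs
  rcases key m with h | h
  · have h' : n ≤ (upperLevel δ (δ i - m * d)).card := by exact_mod_cast hm.trans h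
    have : 0 < n := i.pos
    omega
  · exact h

theorem sub_le_of_level_bounds (hw : ∀ e, 0 ≤ w e) (h1 : IsExpanding w K β)
    (h2 : ∀ s, (upperLevel δ s).Nonempty → 2 * (upperLevel δ s).card ≤ n →
      ∑ e ∈ pairsBetween (upperLevel δ s) (upperLevel δ s)ᶜ, w e * |relScore δ e|
        ≤ γ * (upperLevel δ s).card)
    (h3 : ∀ s, (upperLevel (-δ) s).Nonempty → 2 * (upperLevel (-δ) s).card ≤ n →
      ∑ e ∈ pairsBetween (upperLevel (-δ) s) (upperLevel (-δ) s)ᶜ, w e * |relScore (-δ) e|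
        ≤ γ * (upperLevel (-δ) s).card)
    (hd : 0 < d) (hγ : γ < β * d) (hK : 0 ≤ K) {m : ℕ} (hm : (n : ℝ) ≤ K ^ m) (i j : Fin n) :
    δ i - δ j ≤ 2 * m * d := by
  have hA := half_lt_card_upperLevel hw h1 h2 hd hγ hK i hm
  have hB := half_lt_card_upperLevel hw h1 h3 hd hγ hK j hm
  -- Two strict majorities share a subject `k`, and `δ k` is within `m * d` of being above `δ i` and
  -- below `δ j`.
  have hnd : ¬ Disjoint (upperLevel δ (δ i - m * d)) (upperLevel (-δ) ((-δ) j - m * d)) := by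
    intro hdis
    have := Finset.card_union_of_disjoint hdis
    have h' := Finset.card_le_univ
      (upperLevel δ (δ i - m * d) ∪ upperLevel (-δ) ((-δ) j - m * d))
    rw [Fintype.card_fin] at h'
    omega
  obtain ⟨k, hk1, hk2⟩ := Finset.not_disjoint_iff.1 hnd
  rw [mem_upperLevel] at hk1 hk2
  simp only [Pi.neg_apply] at hk2
  linarith

end Chain


/-! ### Davidson's link as an exponential family -/

/-- The logarithm of the normalizing factor `e^{y/2} + θ + e^{-y/2}`. -/
def logPartition (θ y : ℝ) : ℝ := Real.log (2 * Real.cosh (y / 2) + θ)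

/-- The derivative of `logPartition θ`, which is half of the mean outcome. -/
def halfMean (θ y : ℝ) : ℝ := Real.sinh (y / 2) / (2 * Real.cosh (y / 2) + θ)

section Link

variable {θ : ℝ}

theorem two_cosh_add_pos (hθ : 0 < θ) (y : ℝ) : 0 < 2 * Real.cosh (y / 2) + θ := by
  have := Real.cosh_pos (y / 2)
  positivity

theorem hasDerivAt_logPartition (hθ : 0 < θ) (y : ℝ) :
    HasDerivAt (logPartition θ) (halfMean θ y) y := by
  have h0 : HasDerivAt (fun y : ℝ => y / 2) (1 / 2) y := (hasDerivAt_id y).div_const 2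
  have h1 := (((Real.hasDerivAt_cosh (y / 2)).comp y h0).const_mul 2).add_const θ
  have h2 := h1.log (two_cosh_add_pos hθ y).ne'
  refine h2.congr_deriv ?_
  simp only [halfMean, Function.comp]
  congr 1
  ring

theorem hasDerivAt_halfMean (hθ : 0 < θ) (y : ℝ) :
    HasDerivAt (halfMean θ)
      ((1 + θ / 2 * Real.cosh (y / 2)) / (2 * Real.cosh (y / 2) + θ) ^ 2) y := by
  have h0 : HasDerivAt (fun y : ℝ => y / 2) (1 / 2) y := (hasDerivAt_id y).div_const 2
  have h1 := (((Real.hasDerivAt_cosh (y / 2)).comp y h0).const_mul 2).add_const θ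
  have h2 := ((Real.hasDerivAt_sinh (y / 2)).comp y h0).div h1 (two_cosh_add_pos hθ y).ne'
  refine h2.congr_deriv ?_
  simp only [Function.comp]
  congr 1
  have := Real.cosh_sq (y / 2)
  linear_combination this

theorem strictMono_halfMean (hθ : 0 < θ) : StrictMono (halfMean θ) := by
  refine strictMono_of_hasDerivAt_pos (hasDerivAt_halfMean hθ) fun y => ?_
  have := Real.cosh_pos (y / 2)
  positivity

theorem convexOn_logPartition (hθ : 0 < θ) : ConvexOn ℝ Set.univ (logPartition θ) := by
  refine MonotoneOn.convexOn_of_deriv convex_univ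
    (fun y _ => (hasDerivAt_logPartition hθ y).continuousAt.continuousWithinAt)
    (fun y _ => (hasDerivAt_logPartition hθ y).differentiableAt.differentiableWithinAt) ?_
  have : deriv (logPartition θ) = halfMean θ := funext fun y => (hasDerivAt_logPartition hθ y).deriv
  rw [this]
  exact (strictMono_halfMean hθ).monotone.monotoneOn _

/-- Quantitative curvature: in the derivative of `halfMean θ` the numerator is at least 1, and `cosh
(y/2) ≤ e^{B/2}` bounds the denominator by `(2 + θ)² e^B`. This is the source of the factor `e^M` in
the rate. -/
theorem mul_sub_le_halfMean_sub (hθ : 0 < θ) {B a b : ℝ} (ha : -B ≤ a) (hab : a ≤ b) (hb : b ≤ B) :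
    Real.exp (-B) / (2 + θ) ^ 2 * (b - a) ≤ halfMean θ b - halfMean θ a := by
  refine (convex_Icc (-B) B).mul_sub_le_image_sub_of_le_deriv
    (fun y _ => (hasDerivAt_halfMean hθ y).continuousAt.continuousWithinAt)
    (fun y _ => (hasDerivAt_halfMean hθ y).differentiableAt.differentiableWithinAt) ?_
    a ⟨ha, hab.trans hb⟩ b ⟨ha.trans hab, hb⟩ hab
  intro y hy
  rw [interior_Icc] at hy
  rw [(hasDerivAt_halfMean hθ y).deriv]
  have hc := Real.one_le_cosh (y / 2)
  have hB : |y| ≤ B := abs_le.2 ⟨hy.1.le, hy.2.le⟩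
  have hc2 : Real.cosh (y / 2) ≤ Real.exp (B / 2) := by
    rw [Real.cosh_eq]
    have e1 : Real.exp (y / 2) ≤ Real.exp (B / 2) := Real.exp_le_exp.2 (by linarith [hy.2])
    have e2 : Real.exp (-(y / 2)) ≤ Real.exp (B / 2) := Real.exp_le_exp.2 (by linarith [hy.1])
    linarith
  have h1 : 2 * Real.cosh (y / 2) + θ ≤ (2 + θ) * Real.exp (B / 2) := by nlinarith
  have h2 : (2 * Real.cosh (y / 2) + θ) ^ 2 ≤ (2 + θ) ^ 2 * Real.exp B := by
    calc _ ≤ ((2 + θ) * Real.exp (B / 2)) ^ 2 := by gcongr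
      _ = (2 + θ) ^ 2 * Real.exp B := by rw [mul_pow, ← Real.exp_nat_mul]; ring_nf
  rw [Real.exp_neg, inv_eq_one_div, div_div, mul_comm]
  have h3 : 0 ≤ θ / 2 * Real.cosh (y / 2) := by positivity
  exact div_le_div₀ (by linarith) (by linarith) (by positivity) h2

theorem davidson_denominator (θ y : ℝ) :
    Real.exp y + θ * Real.exp (y / 2) + 1
      = Real.exp (y / 2) * (2 * Real.cosh (y / 2) + θ) := by
  rw [Real.cosh_eq]
  have h1 : Real.exp (y / 2) * Real.exp (y / 2) = Real.exp y := by
    rw [← Real.exp_add]; congr 1; ring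
  have h2 : Real.exp (y / 2) * Real.exp (-(y / 2)) = 1 := by
    rw [← Real.exp_add]; simp
  linear_combination -h1 - h2

theorem davidson_sub_davidson (hθ : 0 < θ) (y : ℝ) :
    davidson θ 1 y - davidson θ (-1) y = 2 * halfMean θ y := by
  have h0 := two_cosh_add_pos hθ y
  have h1 : Real.exp (y / 2) * Real.exp (y / 2) = Real.exp y := by
    rw [← Real.exp_add]; congr 1; ring
  have h2 : Real.exp (y / 2) * Real.exp (-(y / 2)) = 1 := by
    rw [← Real.exp_add]; simp
  simp only [davidson, halfMean, davidson_denominator, if_true]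
  norm_num
  rw [Real.sinh_eq]
  have h3 := Real.exp_pos (y / 2)
  field_simp
  linear_combination -h1 + h2

theorem davidson_sum (hθ : 0 < θ) (y : ℝ) :
    davidson θ 1 y + davidson θ 0 y + davidson θ (-1) y = 1 := by
  have h0 : 0 < Real.exp y + θ * Real.exp (y / 2) + 1 := by positivity
  simp only [davidson]
  norm_num
  field_simp

/-- Dividing numerator and denominator by `e^{y/2}` exhibits an exponential family with sufficient
statistic `x / 2`; the tie term does not depend on `y` and drops out of the maximization. -/
theorem log_davidson (hθ : 0 < θ) {x : ℤ} (hx : x ∈ ({-1, 0, 1} : Set ℤ)) (y : ℝ) :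
    Real.log (davidson θ x y)
      = (x : ℝ) / 2 * y - logPartition θ y + if x = 0 then Real.log θ else 0 := by
  have h0 := two_cosh_add_pos hθ y
  have h3 := Real.exp_pos (y / 2)
  rcases hx with rfl | rfl | rfl
  · simp only [davidson, davidson_denominator, logPartition]
    norm_num
    rw [← mul_inv, mul_comm, Real.log_inv, Real.log_mul (by positivity) (by positivity), Real.log_exp]
    ring
  · simp only [davidson, davidson_denominator, logPartition]
    norm_num
    rw [Real.log_div (by positivity) (by positivity), Real.log_mul hθ.ne' h3.ne',
      Real.log_mul h3.ne' h0.ne', Real.log_exp]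
    ring
  · simp only [davidson, davidson_denominator, logPartition]
    norm_num
    rw [Real.log_div (by positivity) (by positivity), Real.log_mul h3.ne' h0.ne', Real.log_exp,
      Real.log_exp]
    ring

end Link

/-! ### The objective, its directional derivatives and concavity -/

/-- The log-likelihood up to a constant: `S e` is half of the sum of the outcomes of the pair `e`,
and `W e` the number of its comparisons. -/
def pairObjective (θ : ℝ) {n : ℕ} (S W : SubjectPair n → ℝ) (v : Fin n → ℝ) : ℝ :=
  ∑ e, (S e * relScore v e - W e * logPartition θ (relScore v e))

/-- The derivative of `pairObjective θ S W` at `v` in the direction `z`. -/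
def pairScore (θ : ℝ) {n : ℕ} (S W : SubjectPair n → ℝ) (v z : Fin n → ℝ) : ℝ :=
  ∑ e, (S e - W e * halfMean θ (relScore v e)) * relScore z e

/-- Half of the sum of the observed outcomes of the pair `e`. -/
def halfOutcomeSum {T n : ℕ} (N : SubjectPair n → ℕ) (X : SubjectPair n → Fin T → ℤ)
    (e : SubjectPair n) : ℝ :=
  ∑ t ∈ Finset.univ.filter (fun t : Fin T => (t : ℕ) < N e), (X e t : ℝ) / 2

section Objective

variable {θ : ℝ} {n T : ℕ}

theorem card_filter_val_lt (T k : ℕ) :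
    (Finset.univ.filter (fun t : Fin T => (t : ℕ) < k)).card = min T k := by
  rcases le_total T k with h | h
  · rw [Finset.filter_true_of_mem fun t _ => t.2.trans_le h]
    simp [h]
  · rw [Fin.card_filter_val_lt]

theorem logLikelihood_eq (hθ : 0 < θ) {N : SubjectPair n → ℕ} {X : SubjectPair n → Fin T → ℤ}
    (hN : ∀ e, N e ≤ T) (hX : ∀ e t, X e t ∈ ({-1, 0, 1} : Set ℤ)) :
    ∃ c : ℝ, ∀ v, logLikelihood θ N X v
      = pairObjective θ (halfOutcomeSum N X) (fun e => (N e : ℝ)) v + c := by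
  refine ⟨∑ e : SubjectPair n, ∑ t ∈ Finset.univ.filter (fun t : Fin T => (t : ℕ) < N e),
    if X e t = 0 then Real.log θ else 0, fun v => ?_⟩
  rw [logLikelihood, pairObjective, ← Finset.sum_add_distrib]
  refine Finset.sum_congr rfl fun e _ => ?_
  rw [Finset.sum_congr rfl fun t _ => log_davidson hθ (hX e t) (relScore v e),
    Finset.sum_add_distrib, Finset.sum_sub_distrib, Finset.sum_const, card_filter_val_lt,
    min_eq_right (hN e), nsmul_eq_mul, halfOutcomeSum, Finset.sum_mul]

theorem relScore_add_smul (v z : Fin n → ℝ) (h : ℝ) (e : SubjectPair n) :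
    relScore (v + h • z) e = relScore v e + h * relScore z e := by
  simp only [relScore, Pi.add_apply, Pi.smul_apply, smul_eq_mul]
  ring

theorem hasDerivAt_pairObjective (hθ : 0 < θ) (S W : SubjectPair n → ℝ) (v z : Fin n → ℝ) :
    HasDerivAt (fun h : ℝ => pairObjective θ S W (v + h • z)) (pairScore θ S W v z) 0 := by
  unfold pairObjective pairScore
  refine HasDerivAt.fun_sum fun e _ => ?_
  simp only [relScore_add_smul]
  have h0 : HasDerivAt (fun h : ℝ => relScore v e + h * relScore z e) (relScore z e) 0 := by
    simpa using ((hasDerivAt_id (0 : ℝ)).mul_const (relScore z e)).const_add (relScore v e)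
  have h1 : HasDerivAt (logPartition θ) (halfMean θ (relScore v e))
      (relScore v e + 0 * relScore z e) := by
    simpa using hasDerivAt_logPartition hθ (relScore v e)
  refine ((h0.const_mul (S e)).sub ((h1.comp 0 h0).const_mul (W e))).congr_deriv ?_
  ring

theorem continuous_pairObjective (hθ : 0 < θ) (S W : SubjectPair n → ℝ) :
    Continuous (pairObjective θ S W) := by
  have hc : Continuous (logPartition θ) :=
    continuous_iff_continuousAt.2 fun y => (hasDerivAt_logPartition hθ y).continuousAt
  have hr : ∀ e : SubjectPair n, Continuous fun v : Fin n → ℝ => relScore v e := fun e =>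
    (continuous_apply _).sub (continuous_apply _)
  unfold pairObjective
  exact continuous_finsetSum _ fun e _ =>
    ((continuous_const.mul (hr e)).sub (continuous_const.mul (hc.comp (hr e))))

theorem concaveOn_pairObjective (hθ : 0 < θ) (S : SubjectPair n → ℝ) {W : SubjectPair n → ℝ}
    (hW : ∀ e, 0 ≤ W e) (s : Set (Fin n → ℝ)) (hs : Convex ℝ s) :
    ConcaveOn ℝ s (pairObjective θ S W) := by
  refine ⟨hs, fun v _ w _ a b ha hb hab => ?_⟩
  simp only [pairObjective, smul_eq_mul, Finset.mul_sum]
  rw [← Finset.sum_add_distrib]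
  refine Finset.sum_le_sum fun e _ => ?_
  have h := (convexOn_logPartition hθ).2 (Set.mem_univ (relScore v e))
    (Set.mem_univ (relScore w e)) ha hb hab
  have hr : relScore (a • v + b • w) e = a * relScore v e + b * relScore w e := by
    simp only [relScore, Pi.add_apply, Pi.smul_apply, smul_eq_mul]; ring
  rw [hr]
  simp only [smul_eq_mul] at h
  nlinarith [mul_le_mul_of_nonneg_left h (hW e)]

theorem pairObjective_add_const (S W : SubjectPair n → ℝ) (v : Fin n → ℝ) (c : ℝ) :
    pairObjective θ S W (fun i => v i + c) = pairObjective θ S W v := by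
  simp [pairObjective, relScore]

theorem pairScore_smul (S W : SubjectPair n → ℝ) (v z : Fin n → ℝ) (s : ℝ) :
    pairScore θ S W v (s • z) = s * pairScore θ S W v z := by
  simp only [pairScore, Finset.mul_sum, relScore, Pi.smul_apply, smul_eq_mul]
  exact Finset.sum_congr rfl fun e _ => by ring

theorem convex_normalizedScores (n : ℕ) : Convex ℝ (normalizedScores n) := by
  intro v hv w hw a b _ _ _ i hi
  simp [hv i hi, hw i hi]

end Objective


/-! ### Deterministic analysis of the maximizer -/

/-- The indicator vector of `U`. -/
def indicatorVec {n : ℕ} (U : Finset (Fin n)) : Fin n → ℝ := fun i => if i ∈ U then 1 else 0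

section Deterministic

variable {θ : ℝ} {n : ℕ}

theorem relScore_indicatorVec_eq_zero {U : Finset (Fin n)} {e : SubjectPair n}
    (he : e ∉ pairsBetween U Uᶜ) : relScore (indicatorVec U) e = 0 := by
  simp only [mem_pairsBetween, Finset.mem_compl] at he
  simp only [relScore, indicatorVec]
  split_ifs <;> simp <;> tauto

theorem relScore_indicatorVec_mem {U : Finset (Fin n)} {e : SubjectPair n}
    (he : e ∈ pairsBetween U Uᶜ) :
    (e.1.1 ∈ U ∧ e.1.2 ∉ U ∧ relScore (indicatorVec U) e = 1) ∨
      (e.1.2 ∈ U ∧ e.1.1 ∉ U ∧ relScore (indicatorVec U) e = -1) := by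
  simp only [mem_pairsBetween, Finset.mem_compl] at he
  rcases he with ⟨h1, h2⟩ | ⟨h1, h2⟩
  · left; simp [relScore, indicatorVec, h1, h2]
  · right; simp [relScore, indicatorVec, h1, h2]

theorem nonpos_of_hasDerivAt_of_eventually_le {f : ℝ → ℝ} {f' : ℝ} (hf : HasDerivAt f f' 0)
    (h : ∀ᶠ t in 𝓝[>] (0 : ℝ), f t ≤ f 0) : f' ≤ 0 := by
  have ht : Tendsto (slope f 0) (𝓝[>] 0) (𝓝 f') :=
    (hasDerivAt_iff_tendsto_slope.1 hf).mono_left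
      (nhdsWithin_mono _ fun x (hx : 0 < x) => hx.ne')
  refine le_of_tendsto ht ?_
  filter_upwards [h, self_mem_nhdsWithin] with t h1 (h2 : 0 < t)
  rw [slope_def_field]
  exact div_nonpos_of_nonpos_of_nonneg (by linarith) (by linarith)

theorem abs_relScore_le_sub {δ : Fin n → ℝ} {r : ℝ} (h : ∀ i j, δ i - δ j ≤ r)
    (e : SubjectPair n) : |relScore δ e| ≤ r :=
  abs_le.2 ⟨by have := h e.1.2 e.1.1; unfold relScore; linarith, h _ _⟩

/-- First-order optimality tested against `-s` times the indicator of `U`. The sign `s` treats upper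
level sets of `v - u` and of `u - v` together; the score at `v` is the noise at `u` minus a
curvature term that dominates the cut sum. -/
theorem sum_cut_le_of_maximal (hθ : 0 < θ) {S W : SubjectPair n → ℝ} (hW : ∀ e, 0 ≤ W e)
    {u v : Fin n → ℝ} {M b s : ℝ} (hM : ∀ e, |relScore u e| ≤ M) (hs : s = 1 ∨ s = -1)
    (hv : ∀ i j, (v - u) i - (v - u) j ≤ 1)
    (hmax : ∀ w, (∀ i j, (w - u) i - (w - u) j ≤ 1) →
      pairObjective θ S W w ≤ pairObjective θ S W v)
    {U : Finset (Fin n)} (hU : ∀ i ∈ U, ∀ j ∉ U, 0 < s * ((v - u) i - (v - u) j))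
    (hb : |pairScore θ S W u (indicatorVec U)| ≤ b * U.card) :
    ∑ e ∈ pairsBetween U Uᶜ, W e * |relScore (v - u) e| ≤
      b / (Real.exp (-(M + 1)) / (2 + θ) ^ 2) * U.card := by
  set z := indicatorVec U with hz
  set κ := Real.exp (-(M + 1)) / (2 + θ) ^ 2 with hκ
  have hκ0 : 0 < κ := by positivity
  have hss : s * s = 1 := by rcases hs with rfl | rfl <;> norm_num
  have h1 : pairScore θ S W v ((-s) • z) ≤ 0 := by
    refine nonpos_of_hasDerivAt_of_eventually_le (hasDerivAt_pairObjective hθ S W v _) ?_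
    -- A shift by less than every gap between `U` and its complement reverses no order across the
    -- cut, so it cannot increase the spread beyond 1.
    have hev : ∀ᶠ h in 𝓝[>] (0 : ℝ), ∀ i j, i ∈ U → j ∉ U →
        h ≤ s * ((v - u) i - (v - u) j) := by
      rw [eventually_all]; intro i
      rw [eventually_all]; intro j
      by_cases hi : i ∈ U
      · by_cases hj : j ∈ U
        · simp [hj]
        · have := (eventually_lt_nhds (hU i hi j hj)).filter_mono
            (nhdsWithin_le_nhds (s := Set.Ioi 0))
          filter_upwards [this] with h hh _ _ using hh.le
      · simp [hi]
    filter_upwards [hev, self_mem_nhdsWithin] with h hh (hpos : 0 < h)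
    rw [zero_smul, add_zero]
    refine hmax _ fun i j => ?_
    have hij := hv i j
    have hA := hh i j
    have hB := hh j i
    simp only [Pi.sub_apply, Pi.add_apply, Pi.smul_apply, smul_eq_mul, hz, indicatorVec] at *
    rcases hs with rfl | rfl <;> split_ifs with h3 h4 h4 <;>
      first
        | linarith
        | (have := hA h3 h4; linarith)
        | (have := hB h4 h3; linarith)
  rw [pairScore_smul] at h1
  have h2 : s * pairScore θ S W v z = s * pairScore θ S W u z -
      ∑ e, W e * ((halfMean θ (relScore v e) - halfMean θ (relScore u e)) *
        (s * relScore z e)) := by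
    simp only [pairScore, Finset.mul_sum]
    rw [← Finset.sum_sub_distrib]
    exact Finset.sum_congr rfl fun e _ => by ring
  have h3 : s * pairScore θ S W u z ≤ b * U.card := by
    refine le_trans (le_abs_self _) ?_
    rw [abs_mul]
    rcases hs with rfl | rfl <;> simpa using hb
  -- On each cut pair `s * relScore z e` has the sign of `relScore (v - u) e`, so every term is
  -- nonnegative. The curvature bound applies with `B = M + 1`, because the spread of `v - u` is at
  -- most 1.
  have h4 : κ * ∑ e ∈ pairsBetween U Uᶜ, W e * |relScore (v - u) e| ≤
      ∑ e, W e * ((halfMean θ (relScore v e) - halfMean θ (relScore u e)) *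
        (s * relScore z e)) := by
    rw [Finset.mul_sum, ← Finset.sum_subset (Finset.subset_univ (pairsBetween U Uᶜ))
      fun e _ he => by rw [relScore_indicatorVec_eq_zero he]; ring]
    refine Finset.sum_le_sum fun e he => ?_
    rw [mul_left_comm]
    refine mul_le_mul_of_nonneg_left ?_ (hW e)
    have hr : relScore v e = relScore u e + relScore (v - u) e := by
      simp only [relScore, Pi.sub_apply]; ring
    have hr1 := abs_le.1 (abs_relScore_le_sub hv e)
    have hu1 := abs_le.1 (hM e)
    have hup : 0 ≤ relScore (v - u) e → κ * relScore (v - u) e ≤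
        halfMean θ (relScore v e) - halfMean θ (relScore u e) := fun h0 => by
      have := mul_sub_le_halfMean_sub hθ (B := M + 1) (a := relScore u e) (b := relScore v e)
        (by linarith) (by linarith) (by linarith)
      rwa [hr, add_sub_cancel_left, ← hr] at this
    have hdn : relScore (v - u) e ≤ 0 → κ * (-relScore (v - u) e) ≤
        halfMean θ (relScore u e) - halfMean θ (relScore v e) := fun h0 => by
      have := mul_sub_le_halfMean_sub hθ (B := M + 1) (a := relScore v e) (b := relScore u e)
        (by linarith) (by linarith) (by linarith)
      have h5 : relScore u e - relScore v e = -relScore (v - u) e := by rw [hr]; ring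
      rwa [h5] at this
    rcases relScore_indicatorVec_mem he with ⟨hi, hj, hze⟩ | ⟨hi, hj, hze⟩
    · have h6 := hU _ hi _ hj
      rw [hz, hze]
      rcases hs with rfl | rfl
      · have h7 : 0 < relScore (v - u) e := by unfold relScore; linarith
        rw [abs_of_pos h7]; have := hup h7.le; linarith
      · have h7 : relScore (v - u) e < 0 := by unfold relScore; linarith
        rw [abs_of_neg h7]; have := hdn h7.le; linarith
    · have h6 := hU _ hi _ hj
      rw [hz, hze]
      rcases hs with rfl | rfl
      · have h7 : relScore (v - u) e < 0 := by unfold relScore; linarith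
        rw [abs_of_neg h7]; have := hdn h7.le; linarith
      · have h7 : 0 < relScore (v - u) e := by unfold relScore; linarith
        rw [abs_of_pos h7]; have := hup h7.le; linarith
  rw [div_mul_eq_mul_div, le_div_iff₀ hκ0]
  linarith

/-- Invariance under adding constants turns the normalized maximum into an unconstrained one, so
every direction is admissible. -/
theorem pairScore_eq_zero_of_isMaxOn (hθ : 0 < θ) {S W : SubjectPair n → ℝ} (o : Fin n)
    (ho : (o : ℕ) = 0) {v : Fin n → ℝ}
    (hv : IsMaxOn (pairObjective θ S W) (normalizedScores n) v) (z : Fin n → ℝ) :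
    pairScore θ S W v z = 0 := by
  have hall : ∀ w, pairObjective θ S W w ≤ pairObjective θ S W v := fun w => by
    rw [← pairObjective_add_const S W w (-w o)]
    refine hv fun i hi => ?_
    have : i = o := Fin.ext (hi.trans ho.symm)
    simp [this]
  refine IsLocalMax.hasDerivAt_eq_zero (f := fun h : ℝ => pairObjective θ S W (v + h • z)) ?_
    (hasDerivAt_pairObjective hθ S W v z)
  exact Eventually.of_forall fun h => by simpa using hall _

/-- Connectedness of the comparison graph: apply expansion with `W = U` to whichever side of the cut
has at most half of the subjects. -/
theorem IsExpanding.sum_cut_pos {W : SubjectPair n → ℝ} {K β : ℝ} (h : IsExpanding W K β)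
    (hβ : 0 < β) (hK : 1 ≤ K) {U : Finset (Fin n)} (h1 : U.Nonempty) (h2 : Uᶜ.Nonempty) :
    0 < ∑ e ∈ pairsBetween U Uᶜ, W e := by
  have key : ∀ V : Finset (Fin n), V.Nonempty → 2 * V.card ≤ n →
      0 < ∑ e ∈ pairsBetween V Vᶜ, W e := fun V hV hc => by
    have hp : (0 : ℝ) < V.card := by exact_mod_cast hV.card_pos
    exact lt_of_lt_of_le (by positivity) (h V V subset_rfl hV (by nlinarith) hc)
  rcases le_total (2 * U.card) n with hc | hc
  · exact key U h1 hc
  · have := key Uᶜ h2 (by rw [Finset.card_compl, Fintype.card_fin]; omega)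
    rwa [compl_compl, pairsBetween_comm] at this

/-- Let `U` be the set where `w - v` is largest. If `U` is proper, its cut carries weight, and
strict monotonicity of `halfMean θ` makes the scores of `v` and `w` along `U` differ, although both
vanish. -/
theorem eq_of_isMaxOn (hθ : 0 < θ) {S W : SubjectPair n → ℝ} (hW : ∀ e, 0 ≤ W e)
    {K β : ℝ} (h : IsExpanding W K β) (hβ : 0 < β) (hK : 1 ≤ K) (o : Fin n) (ho : (o : ℕ) = 0)
    {v w : Fin n → ℝ} (hv0 : v ∈ normalizedScores n) (hw0 : w ∈ normalizedScores n)
    (hv : IsMaxOn (pairObjective θ S W) (normalizedScores n) v)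
    (hw : IsMaxOn (pairObjective θ S W) (normalizedScores n) w) : w = v := by
  obtain ⟨i₀, -, hi₀⟩ := Finset.exists_max_image Finset.univ (fun i => w i - v i)
    ⟨o, Finset.mem_univ o⟩
  set U := Finset.univ.filter fun i => w i - v i = w i₀ - v i₀ with hU
  have hmem : ∀ i, i ∈ U ↔ w i - v i = w i₀ - v i₀ := fun i => by simp [hU]
  rcases Uᶜ.eq_empty_or_nonempty with hemp | hne
  · have hall : ∀ i, w i - v i = w i₀ - v i₀ := fun i => by
      rw [← hmem]
      by_contra hi
      exact Finset.notMem_empty i (hemp ▸ Finset.mem_compl.2 hi)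
    funext i
    have h1 := hall i
    have h2 := hall o
    rw [hv0 o ho, hw0 o ho] at h2
    linarith
  · exfalso
    have hpos := h.sum_cut_pos hβ hK ⟨i₀, (hmem i₀).2 rfl⟩ hne
    obtain ⟨e₀, he₀, hWe⟩ : ∃ e ∈ pairsBetween U Uᶜ, 0 < W e := by
      by_contra! hcon
      exact absurd hpos (not_lt.2 (Finset.sum_nonpos hcon))
    have hs1 := pairScore_eq_zero_of_isMaxOn hθ o ho hv (indicatorVec U)
    have hs2 := pairScore_eq_zero_of_isMaxOn hθ o ho hw (indicatorVec U)
    have hmono := strictMono_halfMean hθ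
    have hlt : ∀ i ∈ U, ∀ j ∉ U, w j - v j < w i - v i := fun i hi j hj => by
      rw [(hmem i).1 hi]
      exact lt_of_le_of_ne (hi₀ j (Finset.mem_univ j)) fun hh => hj ((hmem j).2 hh)
    have hterm : ∀ e ∈ pairsBetween U Uᶜ, 0 <
        (halfMean θ (relScore w e) - halfMean θ (relScore v e)) *
          relScore (indicatorVec U) e := fun e he => by
      rcases relScore_indicatorVec_mem he with ⟨hi, hj, hze⟩ | ⟨hi, hj, hze⟩
      · have h6 := hlt _ hi _ hj
        have h7 := hmono (show relScore v e < relScore w e by unfold relScore; linarith)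
        rw [hze]; linarith
      · have h6 := hlt _ hi _ hj
        have h7 := hmono (show relScore w e < relScore v e by unfold relScore; linarith)
        rw [hze]; linarith
    have hsum : 0 < ∑ e, W e * ((halfMean θ (relScore w e) - halfMean θ (relScore v e)) *
        relScore (indicatorVec U) e) := by
      rw [← Finset.sum_subset (Finset.subset_univ (pairsBetween U Uᶜ))
        fun e _ he => by rw [relScore_indicatorVec_eq_zero he]; ring]
      exact Finset.sum_pos' (fun e he => mul_nonneg (hW e) (hterm e he).le)
        ⟨e₀, he₀, mul_pos hWe (hterm e₀ he₀)⟩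
    have hdiff : pairScore θ S W v (indicatorVec U) - pairScore θ S W w (indicatorVec U) =
        ∑ e, W e * ((halfMean θ (relScore w e) - halfMean θ (relScore v e)) *
        relScore (indicatorVec U) e) := by
      simp only [pairScore]
      rw [← Finset.sum_sub_distrib]
      exact Finset.sum_congr rfl fun e _ => by ring
    rw [hs1, hs2] at hdiff
    linarith

/-- The spread constraint with one pinned coordinate is compact; shift invariance then removes the
pinning from the competitors. -/
theorem exists_maximizer_near (hθ : 0 < θ) {S W : SubjectPair n → ℝ} (o : Fin n)
    (ho : (o : ℕ) = 0) {u : Fin n → ℝ} (hu : u ∈ normalizedScores n) :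
    ∃ v ∈ normalizedScores n, (∀ i j, (v - u) i - (v - u) j ≤ 1) ∧
      ∀ w, (∀ i j, (w - u) i - (w - u) j ≤ 1) →
        pairObjective θ S W w ≤ pairObjective θ S W v := by
  set A : Set (Fin n → ℝ) := {v | v o = 0 ∧ ∀ i j, (v - u) i - (v - u) j ≤ 1} with hA
  have hcl : IsClosed A := by
    rw [hA, Set.ofPred_and]
    refine (isClosed_eq (continuous_apply o) continuous_const).inter ?_
    simp only [Set.ofPred_forall]
    refine isClosed_iInter fun i => isClosed_iInter fun j => isClosed_le ?_ continuous_const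
    simp only [Pi.sub_apply]
    fun_prop
  have hbd : Bornology.IsBounded A := by
    refine (Metric.isBounded_iff_subset_closedBall u).2 ⟨1, fun v hv => ?_⟩
    rw [mem_closedBall_iff_norm, pi_norm_le_iff_of_nonneg zero_le_one]
    intro i
    have h1 := hv.2 i o
    have h2 := hv.2 o i
    have h3 := hu o ho
    simp only [Pi.sub_apply, hv.1, h3] at h1 h2 ⊢
    rw [Real.norm_eq_abs, abs_le]
    constructor <;> linarith
  have hne : A.Nonempty := ⟨u, hu o ho, fun i j => by simp⟩
  obtain ⟨v, hvA, hv⟩ := (Metric.isCompact_of_isClosed_isBounded hcl hbd).exists_isMaxOn hne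
    (continuous_pairObjective hθ S W).continuousOn
  refine ⟨v, fun i hi => ?_, hvA.2, fun w hw => ?_⟩
  · rw [Fin.ext (hi.trans ho.symm)]; exact hvA.1
  · rw [← pairObjective_add_const S W w (-w o)]
    refine hv ⟨by simp, fun i j => ?_⟩
    have := hw i j
    simp only [Pi.sub_apply] at this ⊢
    linarith

theorem existsUnique_maximizer_of_isExpanding (hθ : 0 < θ) (hn : 0 < n)
    {S W : SubjectPair n → ℝ} (hW : ∀ e, 0 ≤ W e) {u : Fin n → ℝ} (hu : u ∈ normalizedScores n)
    {M b K β d : ℝ} {m : ℕ} (hM : ∀ e, |relScore u e| ≤ M)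
    (hexp : IsExpanding W K β) (hβ : 0 < β) (hK : 1 ≤ K)
    (hb : ∀ U : Finset (Fin n), U.Nonempty → 2 * U.card ≤ n →
      |pairScore θ S W u (indicatorVec U)| ≤ b * U.card)
    (hd : 0 < d) (hγ : b / (Real.exp (-(M + 1)) / (2 + θ) ^ 2) < β * d)
    (hm : (n : ℝ) ≤ K ^ m) (hmd : 2 * m * d < 1) :
    ∃ v ∈ normalizedScores n, IsMaxOn (pairObjective θ S W) (normalizedScores n) v ∧
      (∀ w ∈ normalizedScores n, IsMaxOn (pairObjective θ S W) (normalizedScores n) w → w = v) ∧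
      ‖v - u‖ ≤ 2 * m * d := by
  have ho : ((⟨0, hn⟩ : Fin n) : ℕ) = 0 := rfl
  generalize (⟨0, hn⟩ : Fin n) = o at ho
  obtain ⟨v, hv0, hv1, hvmax⟩ := exists_maximizer_near (S := S) (W := W) hθ o ho hu
  have hrange : ∀ i j, (v - u) i - (v - u) j ≤ 2 * m * d := by
    refine sub_le_of_level_bounds hW hexp ?_ ?_ hd hγ (by linarith) hm
    · intro s hs1 hs2
      refine sum_cut_le_of_maximal hθ hW hM (Or.inl rfl) hv1 hvmax (fun i hi j hj => ?_)
        (hb _ hs1 hs2)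
      rw [mem_upperLevel] at hi hj
      linarith
    · intro s hs1 hs2
      have habs : ∀ e : SubjectPair n, |relScore (-(v - u)) e| = |relScore (v - u) e| :=
        fun e => by
          rw [← abs_neg]; congr 1; simp only [relScore, Pi.neg_apply]; ring
      simp only [habs]
      refine sum_cut_le_of_maximal hθ hW hM (Or.inr rfl) hv1 hvmax (fun i hi j hj => ?_)
        (hb _ hs1 hs2)
      rw [mem_upperLevel] at hi hj
      simp only [Pi.neg_apply] at hi hj
      linarith
  have hmax : IsMaxOn (pairObjective θ S W) (normalizedScores n) v := by
    refine IsMaxOn.of_isLocalMaxOn_of_concaveOn hv0 ?_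
      (concaveOn_pairObjective hθ S hW _ (convex_normalizedScores n))
    -- The spread bound is strictly below 1, so the constraint is inactive near `v` and the local
    -- maximum is global by concavity.
    have hev : ∀ᶠ w in 𝓝 v, ∀ i j, (w - u) i - (w - u) j < 1 := by
      rw [eventually_all]; intro i
      rw [eventually_all]; intro j
      have hc : Continuous fun w : Fin n → ℝ => (w - u) i - (w - u) j := by
        simp only [Pi.sub_apply]; fun_prop
      exact hc.continuousAt.eventually_lt continuousAt_const ((hrange i j).trans_lt hmd)
    exact (hev.mono fun w hw => hvmax w fun i j => (hw i j).le).filter_mono nhdsWithin_le_nhds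
  refine ⟨v, hv0, hmax, fun w hw0 hw => eq_of_isMaxOn hθ hW hexp hβ hK o ho hv0 hw0 hmax hw, ?_⟩
  rw [pi_norm_le_iff_of_nonneg (by positivity)]
  intro i
  have h1 := hrange i o
  have h2 := hrange o i
  simp only [Pi.sub_apply, hv0 o ho, hu o ho] at h1 h2 ⊢
  rw [Real.norm_eq_abs, abs_le]
  constructor <;> linarith

end Deterministic


/-! ### Exponential moments of binomial counts -/

section Moments

variable {Ω : Type*} [MeasurableSpace Ω] {μ : Measure Ω}

/-- Fubini in place of conditioning: the counts can be frozen while the outcomes are integrated. -/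
theorem lintegral_comp_indepFun {α β : Type*} [MeasurableSpace α] [MeasurableSpace β]
    [IsProbabilityMeasure μ] {A : Ω → α} {B : Ω → β} (hA : Measurable A) (hB : Measurable B)
    (hAB : IndepFun A B μ) {g : α × β → ENNReal} (hg : Measurable g) :
    ∫⁻ ω, g (A ω, B ω) ∂μ = ∫⁻ ω, ∫⁻ ω', g (A ω, B ω') ∂μ ∂μ := by
  have := Measure.isProbabilityMeasure_map (μ := μ) hA.aemeasurable
  have := Measure.isProbabilityMeasure_map (μ := μ) hB.aemeasurable
  rw [← lintegral_map (μ := μ) hg (hA.prodMk hB),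
    (indepFun_iff_map_prod_eq_prod_map_map hA.aemeasurable hB.aemeasurable).1 hAB,
    lintegral_prod _ hg.aemeasurable, lintegral_map hg.lintegral_prod_right' hA]
  exact lintegral_congr fun ω => lintegral_map (hg.comp measurable_prodMk_left) hB

theorem lintegral_exp_binomial_le {T : ℕ} {p : unitInterval} {Y : Ω → ℕ}
    (hY : HasLaw Y (ProbabilityTheory.binomial T p) μ) (t : ℝ) :
    ∫⁻ ω, ENNReal.ofReal (Real.exp (t * Y ω)) ∂μ
      ≤ ENNReal.ofReal (Real.exp (T * p * (Real.exp t - 1))) := by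
  have h1 : ∫⁻ ω, ENNReal.ofReal (Real.exp (t * Y ω)) ∂μ =
      ∫⁻ k, ENNReal.ofReal (Real.exp (t * k)) ∂(ProbabilityTheory.binomial T p) := by
    rw [← hY.map_eq, lintegral_map' (measurable_of_countable _).aemeasurable hY.aemeasurable]
  rw [h1, ← ofReal_integral_eq_lintegral_ofReal (integrable_binomial _)
    (ae_of_all _ fun k => (Real.exp_pos _).le), integral_binomial]
  refine ENNReal.ofReal_le_ofReal ?_
  have h2 : ∑ k ∈ Finset.Iic T, ((T.choose k : ℝ) * (p : ℝ) ^ k * (1 - p) ^ (T - k)) •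
      Real.exp (t * k) = (p * Real.exp t + (1 - p)) ^ T := by
    rw [add_pow, ← Nat.range_succ_eq_Iic]
    refine Finset.sum_congr rfl fun k _ => ?_
    rw [smul_eq_mul, mul_pow, ← Real.exp_nat_mul]
    ring_nf
  rw [h2, mul_assoc, Real.exp_nat_mul]
  have hp0 := p.2.1
  have hp1 := p.2.2
  refine pow_le_pow_left₀ (by have := Real.exp_pos t; nlinarith) ?_ T
  have := Real.add_one_le_exp ((p : ℝ) * (Real.exp t - 1))
  linarith

theorem lintegral_exp_sum_binomial_le {ι : Type*} [Fintype ι] {T : ℕ} {p : unitInterval}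
    {Y : ι → Ω → ℕ} (hm : ∀ i, Measurable (Y i))
    (hY : ∀ i, HasLaw (Y i) (ProbabilityTheory.binomial T p) μ)
    (hind : iIndepFun Y μ) (s : Finset ι) (t : ℝ) :
    ∫⁻ ω, ENNReal.ofReal (Real.exp (t * ∑ i ∈ s, (Y i ω : ℝ))) ∂μ
      ≤ ENNReal.ofReal (Real.exp (T * p * s.card * (Real.exp t - 1))) := by
  have hmk : Measurable fun k : ℕ => ENNReal.ofReal (Real.exp (t * k)) := measurable_of_countable _
  have h1 : ∀ ω, ENNReal.ofReal (Real.exp (t * ∑ i ∈ s, (Y i ω : ℝ))) =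
      ∏ i ∈ s, ENNReal.ofReal (Real.exp (t * Y i ω)) := fun ω => by
    rw [Finset.mul_sum, Real.exp_sum, ENNReal.ofReal_prod_of_nonneg
      fun i _ => (Real.exp_pos _).le]
  simp only [h1]
  rw [lintegral_prod_eq_prod_lintegral_of_indepFun s
    (fun i ω => ENNReal.ofReal (Real.exp (t * Y i ω)))
    (hind.comp (fun _ k => ENNReal.ofReal (Real.exp (t * k))) fun _ => hmk)
    fun i => hmk.comp (hm i)]
  refine (Finset.prod_le_prod' fun i _ => lintegral_exp_binomial_le (hY i) t).trans ?_
  rw [Finset.prod_const, ← ENNReal.ofReal_pow (Real.exp_pos _).le, ← Real.exp_nat_mul]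
  exact le_of_eq (by ring_nf)

theorem measureReal_ge_le_of_lintegral_exp_le [IsFiniteMeasure μ] {Z : Ω → ℝ} (hZ : Measurable Z)
    {a c : ℝ} (h : ∫⁻ ω, ENNReal.ofReal (Real.exp (Z ω)) ∂μ ≤ ENNReal.ofReal (Real.exp c)) :
    μ.real {ω | a ≤ Z ω} ≤ Real.exp (c - a) := by
  have hmeas : Measurable fun ω => ENNReal.ofReal (Real.exp (Z ω)) := by fun_prop
  have h1 := mul_meas_ge_le_lintegral hmeas (μ := μ) (ENNReal.ofReal (Real.exp a))
  have hset : {ω | ENNReal.ofReal (Real.exp a) ≤ ENNReal.ofReal (Real.exp (Z ω))}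
      = {ω | a ≤ Z ω} := by
    ext ω
    simp [ENNReal.ofReal_le_ofReal_iff (Real.exp_pos _).le]
  rw [hset] at h1
  have h2 := ENNReal.toReal_mono ENNReal.ofReal_ne_top (h1.trans h)
  rw [ENNReal.toReal_mul, ENNReal.toReal_ofReal (Real.exp_pos _).le,
    ENNReal.toReal_ofReal (Real.exp_pos _).le] at h2
  rw [Real.exp_sub, le_div_iff₀ (Real.exp_pos _), mul_comm]
  exact h2

/-- Lower tail of a sum of independent binomial counts. -/
theorem measureReal_sum_binomial_lt_le {ι : Type*} [Fintype ι] [IsFiniteMeasure μ] {T : ℕ}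
    {p : unitInterval} {Y : ι → Ω → ℕ} (hm : ∀ i, Measurable (Y i))
    (hY : ∀ i, HasLaw (Y i) (ProbabilityTheory.binomial T p) μ)
    (hind : iIndepFun Y μ) (s : Finset ι) :
    μ.real {ω | ∑ i ∈ s, (Y i ω : ℝ) < T * p * s.card / 2}
      ≤ Real.exp (-(T * p * s.card / 8)) := by
  have hmeas : Measurable fun ω => (-1 : ℝ) * ∑ i ∈ s, (Y i ω : ℝ) :=
    (Finset.measurable_sum _ fun i _ =>
      (measurable_of_countable (fun k : ℕ => (k : ℝ))).comp (hm i)).const_mul _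
  have h := measureReal_ge_le_of_lintegral_exp_le hmeas (a := -(T * p * s.card / 2))
    (lintegral_exp_sum_binomial_le hm hY hind s (-1))
  refine (measureReal_mono fun ω hω => ?_).trans (h.trans (Real.exp_le_exp.2 ?_))
  · rw [Set.mem_ofPred_eq] at hω ⊢
    linarith
  -- Chernoff at parameter `-1`: the exponent is `(e⁻¹ - 1 + 1/2)` times the mean, hence at most
  -- `-1/8` of it.
  · have he : Real.exp (-1) ≤ 3 / 8 := by
      rw [Real.exp_neg, inv_le_comm₀ (Real.exp_pos _) (by norm_num)]
      have := Real.exp_one_gt_d9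
      norm_num at this ⊢
      linarith
    have hp0 := p.2.1
    have : (0 : ℝ) ≤ T * p * s.card := by positivity
    nlinarith

end Moments

/-! ### Noise across a cut -/

section Davidson

variable {Ω : Type*} [MeasurableSpace Ω] {μ : Measure Ω} [IsProbabilityMeasure μ] {θ : ℝ}
  {T n : ℕ} {p : unitInterval} {u : Fin n → ℝ} {N : SubjectPair n → Ω → ℕ}
  {X : SubjectPair n → Fin T → Ω → ℤ}

theorem IsDavidsonData.ae_outcome_mem (D : IsDavidsonData μ θ T p u N X) (hθ : 0 < θ)
    (e : SubjectPair n) (t : Fin T) : ∀ᵐ ω ∂μ, X e t ω ∈ ({-1, 0, 1} : Set ℤ) := by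
  have hm : ∀ x : ℤ, MeasurableSet {ω | X e t ω = x} := fun x =>
    D.measurable_outcome e t (measurableSet_singleton x)
  have h1 : μ.real ({ω | X e t ω = 1} ∪ {ω | X e t ω = 0} ∪ {ω | X e t ω = -1}) = 1 := by
    rw [measureReal_union _ (hm _), measureReal_union _ (hm _),
      D.law_outcome e t 1 (by simp), D.law_outcome e t 0 (by simp),
      D.law_outcome e t (-1) (by simp), davidson_sum hθ]
    · rw [Set.disjoint_left]; intro ω (h : _ = _) (h' : _ = _); omega
    · rw [Set.disjoint_left]
      rintro ω ((h : _ = _) | (h : _ = _)) (h' : _ = _) <;> omega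
  have h2 := (prob_compl_eq_zero_iff (μ := μ) (((hm 1).union (hm 0)).union (hm (-1)))).2
    (by rw [← ENNReal.toReal_eq_one_iff]; exact h1)
  rw [ae_iff]
  refine measure_mono_null (fun ω hω => ?_) h2
  simp only [Set.mem_insert_iff, Set.mem_singleton_iff, Set.mem_ofPred_eq] at hω
  simp only [Set.mem_compl_iff, Set.mem_union, Set.mem_ofPred_eq]
  tauto

theorem IsDavidsonData.integral_outcome (D : IsDavidsonData μ θ T p u N X) (hθ : 0 < θ)
    (e : SubjectPair n) (t : Fin T) :
    ∫ ω, (X e t ω : ℝ) / 2 ∂μ = halfMean θ (relScore u e) := by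
  have hm : ∀ x : ℤ, MeasurableSet {ω | X e t ω = x} := fun x =>
    D.measurable_outcome e t (measurableSet_singleton x)
  have h1 : (fun ω => (X e t ω : ℝ)) =ᵐ[μ] fun ω =>
      Set.indicator {ω | X e t ω = 1} (fun _ => (1 : ℝ)) ω -
        Set.indicator {ω | X e t ω = -1} (fun _ => (1 : ℝ)) ω := by
    filter_upwards [D.ae_outcome_mem hθ e t] with ω hω
    simp only [Set.indicator_apply, Set.mem_ofPred_eq]
    rcases hω with h | h | h
    · norm_num [h]
    · norm_num [h]
    · replace h : X e t ω = 1 := h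
      norm_num [h]
  rw [integral_div, integral_congr_ae h1, integral_sub
    ((integrable_const _).indicator (hm 1)) ((integrable_const _).indicator (hm (-1))),
    integral_indicator_const _ (hm 1), integral_indicator_const _ (hm (-1)),
    D.law_outcome e t 1 (by simp), D.law_outcome e t (-1) (by simp)]
  have := davidson_sub_davidson hθ (relScore u e)
  simp only [smul_eq_mul, mul_one]
  linarith

theorem IsDavidsonData.hasSubgaussianMGF_outcome (D : IsDavidsonData μ θ T p u N X) (hθ : 0 < θ)
    (e : SubjectPair n) (t : Fin T) :
    HasSubgaussianMGF (fun ω => (X e t ω : ℝ) / 2 - halfMean θ (relScore u e)) (1 / 4) μ := by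
  have hm : Measurable fun ω => (X e t ω : ℝ) / 2 :=
    (measurable_of_countable (fun k : ℤ => (k : ℝ) / 2)).comp (D.measurable_outcome e t)
  have h := hasSubgaussianMGF_of_mem_Icc (μ := μ) (a := -(1 / 2)) (b := 1 / 2) hm.aemeasurable
    (by
      filter_upwards [D.ae_outcome_mem hθ e t] with ω hω
      rcases hω with h | h | h
      · norm_num [h]
      · norm_num [h]
      · replace h : X e t ω = 1 := h
        norm_num [h])
  rw [D.integral_outcome hθ e t] at h
  convert h using 1
  apply NNReal.eq
  norm_num

/-- The noise of the score in the direction of the indicator vector of `U`, for counts `ν`. -/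
def cutNoise (θ : ℝ) (u : Fin n → ℝ) (U : Finset (Fin n)) (ν : SubjectPair n → ℕ)
    (x : SubjectPair n × Fin T → ℤ) : ℝ :=
  ∑ q ∈ (pairsBetween U Uᶜ ×ˢ (Finset.univ : Finset (Fin T))).filter (fun q => (q.2 : ℕ) < ν q.1),
    relScore (indicatorVec U) q.1 * ((x q : ℝ) / 2 - halfMean θ (relScore u q.1))

theorem pairScore_eq_cutNoise {ν : SubjectPair n → ℕ} (hν : ∀ e, ν e ≤ T)
    (x : SubjectPair n × Fin T → ℤ) (U : Finset (Fin n)) :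
    pairScore θ (halfOutcomeSum ν fun e t => x (e, t)) (fun e => (ν e : ℝ)) u (indicatorVec U)
      = cutNoise θ u U ν x := by
  rw [pairScore, cutNoise, Finset.sum_filter, Finset.sum_product,
    ← Finset.sum_subset (Finset.subset_univ (pairsBetween U Uᶜ))
        fun e _ he => by rw [relScore_indicatorVec_eq_zero he]; ring]
  refine Finset.sum_congr rfl fun e _ => ?_
  rw [← Finset.sum_filter]
  simp only
  rw [← Finset.mul_sum, Finset.sum_sub_distrib, Finset.sum_const,
    card_filter_val_lt, min_eq_right (hν e), nsmul_eq_mul, halfOutcomeSum, mul_comm]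

theorem IsDavidsonData.lintegral_exp_cutNoise_le (D : IsDavidsonData μ θ T p u N X) (hθ : 0 < θ)
    (U : Finset (Fin n)) (ν : SubjectPair n → ℕ) (t : ℝ) :
    ∫⁻ ω, ENNReal.ofReal (Real.exp (t * cutNoise θ u U ν fun q => X q.1 q.2 ω)) ∂μ
      ≤ ENNReal.ofReal (Real.exp (t ^ 2 / 8 * ∑ e ∈ pairsBetween U Uᶜ, (ν e : ℝ))) := by
  set Q := (pairsBetween U Uᶜ ×ˢ (Finset.univ : Finset (Fin T))).filter
    (fun q => (q.2 : ℕ) < ν q.1) with hQ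
  have hind : iIndepFun (fun (q : SubjectPair n × Fin T) ω => relScore (indicatorVec U) q.1 *
      ((X q.1 q.2 ω : ℝ) / 2 - halfMean θ (relScore u q.1))) μ :=
    D.indep_outcome.comp (fun q (k : ℤ) => relScore (indicatorVec U) q.1 *
      ((k : ℝ) / 2 - halfMean θ (relScore u q.1))) fun q => measurable_of_countable _
  have hsub : ∀ q ∈ Q, HasSubgaussianMGF (fun ω => relScore (indicatorVec U) q.1 *
      ((X q.1 q.2 ω : ℝ) / 2 - halfMean θ (relScore u q.1))) (1 / 4) μ := fun q hq => by
    rw [hQ, Finset.mem_filter, Finset.mem_product] at hq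
    have h0 := D.hasSubgaussianMGF_outcome hθ q.1 q.2
    rcases relScore_indicatorVec_mem hq.1.1 with ⟨-, -, hz⟩ | ⟨-, -, hz⟩
    · simpa only [hz, one_mul] using h0
    · simpa only [hz, neg_mul, one_mul] using! h0.neg
  have h := HasSubgaussianMGF.sum_of_iIndepFun hind hsub
  have hle := h.mgf_le t
  unfold cutNoise
  rw [← ofReal_integral_eq_lintegral_ofReal (h.integrable_exp_mul t)
    (ae_of_all _ fun ω => (Real.exp_pos _).le)]
  refine ENNReal.ofReal_le_ofReal (hle.trans (Real.exp_le_exp.2 ?_))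
  have hcard : (Q.card : ℝ) ≤ ∑ e ∈ pairsBetween U Uᶜ, (ν e : ℝ) := by
    rw [hQ, Finset.card_filter, Finset.sum_product, Nat.cast_sum]
    refine Finset.sum_le_sum fun e _ => ?_
    rw [← Finset.card_filter]
    simp only
    rw [card_filter_val_lt]
    exact_mod_cast min_le_right _ _
  rw [Finset.sum_const, nsmul_eq_mul]
  push_cast
  nlinarith [sq_nonneg t]

theorem measurable_cutNoise (hN : ∀ e, Measurable (N e)) (hX : ∀ e t, Measurable (X e t))
    (U : Finset (Fin n)) :
    Measurable fun ω => cutNoise θ u U (fun e => N e ω) fun q => X q.1 q.2 ω := by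
  have h1 : Measurable fun r : (SubjectPair n → ℕ) × (SubjectPair n × Fin T → ℤ) =>
    cutNoise θ u U r.1 r.2 := measurable_of_countable _
  have h2 : Measurable fun ω e => N e ω := measurable_pi_lambda _ hN
  have h3 : Measurable fun ω (q : SubjectPair n × Fin T) => X q.1 q.2 ω :=
    measurable_pi_lambda _ fun q => hX q.1 q.2
  have h := h1.comp (h2.prodMk h3)
  rw [Function.comp_def] at h
  exact h

/-- Given the counts the noise is sub-Gaussian with variance proxy at most a quarter of the number
of comparisons on the cut; averaging over the binomial counts costs only a constant, because `ε ≤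
1`. -/
theorem IsDavidsonData.measureReal_cutNoise_ge_le (D : IsDavidsonData μ θ T p u N X) (hθ : 0 < θ)
    (U : Finset (Fin n)) {ε s : ℝ} (hε0 : 0 ≤ ε) (hε : ε ≤ 1) (hs : s = 1 ∨ s = -1) :
    μ.real {ω | ε * (T * p * n) * U.card ≤
        s * cutNoise θ u U (fun e => N e ω) fun q => X q.1 q.2 ω}
      ≤ Real.exp (-(ε ^ 2 * (T * p * n) * U.card)) := by
  rcases hε0.eq_or_lt with rfl | hε0
  · simp
  have hss : s ^ 2 = 1 := by rcases hs with rfl | rfl <;> norm_num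
  -- With this choice the log-moment is at most `ε² T p n |U|`, while the Chernoff threshold
  -- contributes `-2 ε² T p n |U|`.
  set t : ℝ := 2 * ε * s with ht
  have hmg : Measurable fun r : (SubjectPair n → ℕ) × (SubjectPair n × Fin T → ℤ) =>
      ENNReal.ofReal (Real.exp (t * cutNoise θ u U r.1 r.2)) := measurable_of_countable _
  have h1 : ∫⁻ ω, ENNReal.ofReal (Real.exp (t * cutNoise θ u U (fun e => N e ω)
      fun q => X q.1 q.2 ω)) ∂μ ≤ ENNReal.ofReal (Real.exp (ε ^ 2 * (T * p * n) * U.card)) := by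
    rw [lintegral_comp_indepFun (measurable_pi_lambda _ D.measurable_count)
      (measurable_pi_lambda _ fun q : SubjectPair n × Fin T => D.measurable_outcome q.1 q.2)
      D.indep_count_outcome hmg]
    refine (lintegral_mono fun ω => D.lintegral_exp_cutNoise_le hθ U (fun e => N e ω) t).trans ?_
    refine (lintegral_exp_sum_binomial_le D.measurable_count D.law_count D.indep_count _ _).trans ?_
    refine ENNReal.ofReal_le_ofReal (Real.exp_le_exp.2 ?_)
    have ht2 : t ^ 2 / 8 = ε ^ 2 / 2 := by rw [ht, mul_pow, hss]; ring
    rw [ht2]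
    have hx0 : 0 ≤ ε ^ 2 / 2 := by positivity
    have hx1 : ε ^ 2 / 2 ≤ 1 := by nlinarith
    have hexp : Real.exp (ε ^ 2 / 2) - 1 ≤ ε ^ 2 := by
      have := (abs_le.1 (Real.abs_exp_sub_one_sub_id_le (x := ε ^ 2 / 2)
        (by rwa [abs_of_nonneg hx0]))).2
      nlinarith
    have hcard : ((pairsBetween U Uᶜ).card : ℝ) ≤ U.card * n := by
      rw [card_pairsBetween disjoint_compl_right]
      have h3 : (Uᶜ).card ≤ n := by simpa using Finset.card_le_univ Uᶜ
      exact_mod_cast Nat.mul_le_mul_left _ h3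
    have hp0 := p.2.1
    calc (T : ℝ) * p * (pairsBetween U Uᶜ).card * (Real.exp (ε ^ 2 / 2) - 1)
        ≤ T * p * (pairsBetween U Uᶜ).card * ε ^ 2 := by gcongr
      _ ≤ T * p * (U.card * n) * ε ^ 2 := by gcongr
      _ = _ := by ring
  have h2 := measureReal_ge_le_of_lintegral_exp_le ((measurable_cutNoise D.measurable_count D.measurable_outcome U).const_mul t)
    (a := 2 * ε * (ε * (T * p * n) * U.card)) h1
  have h4 : ε ^ 2 * (T * p * n) * U.card - 2 * ε * (ε * (T * p * n) * U.card)
      = -(ε ^ 2 * (T * p * n) * U.card) := by ring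
  rw [h4] at h2
  refine (measureReal_mono fun ω hω => ?_).trans h2
  rw [Set.mem_ofPred_eq] at hω ⊢
  rw [ht, mul_assoc (2 * ε) s]
  exact mul_le_mul_of_nonneg_left hω (by positivity)

end Davidson


/-! ### Union bounds over vertex sets -/

/-- The data are possible outcomes of Davidson's model, their comparison graph expands, and the
noise across every cut is small. -/
structure IsRegularData (θ : ℝ) {T n : ℕ} (p : ℝ) (u : Fin n → ℝ) (K ε : ℝ)
    (ν : SubjectPair n → ℕ) (x : SubjectPair n → Fin T → ℤ) : Prop where
  count_le : ∀ e, ν e ≤ T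
  outcome_mem : ∀ e t, x e t ∈ ({-1, 0, 1} : Set ℤ)
  expanding : IsExpanding (fun e => (ν e : ℝ)) K (T * p * n / 4)
  noise_lt : ∀ U : Finset (Fin n), U.Nonempty →
    |cutNoise θ u U ν fun q => x q.1 q.2| < ε * (T * p * n) * U.card

/-- The sum is `(1 + 1/n)^n`. A failure probability `n^{-|U|}` per set thus survives a union bound
over all sets. -/
theorem sum_pow_card_le_exp_one {n : ℕ} (hn : 0 < n) :
    ∑ U : Finset (Fin n), ((n : ℝ)⁻¹) ^ U.card ≤ Real.exp 1 := by
  have h := Fin.sum_pow_mul_eq_add_pow ((n : ℝ)⁻¹) 1 (n := n)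
  simp only [one_pow, mul_one] at h
  rw [h]
  have hn' : (n : ℝ) ≠ 0 := by positivity
  calc ((n : ℝ)⁻¹ + 1) ^ n ≤ Real.exp ((n : ℝ)⁻¹) ^ n :=
        pow_le_pow_left₀ (by positivity) (Real.add_one_le_exp _) n
    _ = Real.exp 1 := by rw [← Real.exp_nat_mul, mul_inv_cancel₀ hn']

theorem exp_neg_mul_log_eq {n : ℕ} (hn : 0 < n) (k : ℕ) :
    Real.exp (-(k * Real.log n)) = ((n : ℝ)⁻¹) ^ k := by
  have hn' : (0 : ℝ) < n := by exact_mod_cast hn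
  rw [← mul_neg, Real.exp_nat_mul, Real.exp_neg, Real.exp_log hn']

section Probability

variable {Ω : Type*} [MeasurableSpace Ω] {μ : Measure Ω} [IsProbabilityMeasure μ] {θ : ℝ}
  {T n : ℕ} {p : unitInterval} {u : Fin n → ℝ} {N : SubjectPair n → Ω → ℕ}
  {X : SubjectPair n → Fin T → Ω → ℤ}

/-- For fixed `U ⊆ W` at least `|U| n / 2` pairs leave `W`, so the failure probability is at most
`exp (-T p n |U| / 16)`. Since `|W| ≤ K |U|`, the hypothesis on `K` makes this at most
`n^{-2-|U|-|W|}`, summable over both sets. -/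
theorem IsDavidsonData.measureReal_not_expanding_le (D : IsDavidsonData μ θ T p u N X)
    (hT : 1 ≤ T) (hn : 0 < n) {K : ℝ} (hK : (3 + K) * Real.log n ≤ n * p / 16) :
    μ.real {ω | ¬ IsExpanding (fun e => (N e ω : ℝ)) K (T * p * n / 4)} ≤
      Real.exp 1 ^ 2 * ((n : ℝ)⁻¹) ^ 2 := by
  classical
  set A : Finset (Finset (Fin n) × Finset (Fin n)) := Finset.univ.filter fun q =>
    q.1 ⊆ q.2 ∧ q.1.Nonempty ∧ (q.2.card : ℝ) ≤ K * q.1.card ∧ 2 * q.2.card ≤ n with hA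
  set B : Finset (Fin n) × Finset (Fin n) → Set Ω := fun q =>
    {ω | ∑ e ∈ pairsBetween q.1 q.2ᶜ, (N e ω : ℝ) < T * p * (pairsBetween q.1 q.2ᶜ).card / 2}
    with hB
  have hp0 := p.2.1
  have hT' : (1 : ℝ) ≤ T := by exact_mod_cast hT
  have hlog : 0 ≤ Real.log n := Real.log_natCast_nonneg n
  have hcard : ∀ q ∈ A, (q.1.card : ℝ) * (n / 2) ≤ (pairsBetween q.1 q.2ᶜ).card := by
    intro q hq
    rw [hA, Finset.mem_filter] at hq
    obtain ⟨-, h1, -, -, h4⟩ := hq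
    rw [card_pairsBetween (disjoint_compl_right.mono_left h1), Nat.cast_mul]
    refine mul_le_mul_of_nonneg_left ?_ (Nat.cast_nonneg _)
    rw [Finset.card_compl, Fintype.card_fin, Nat.cast_sub (by omega)]
    have : (2 : ℝ) * q.2.card ≤ n := by exact_mod_cast h4
    linarith
  have hsub : {ω | ¬ IsExpanding (fun e => (N e ω : ℝ)) K (T * p * n / 4)} ⊆
      ⋃ q ∈ A, B q := by
    intro ω hω
    simp only [Set.mem_ofPred_eq, IsExpanding, not_forall, not_le] at hω
    obtain ⟨U, W, h1, h2, h3, h4, h5⟩ := hω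
    have hmem : (U, W) ∈ A := by
      rw [hA, Finset.mem_filter]
      exact ⟨Finset.mem_univ _, h1, h2, h3, h4⟩
    refine Set.mem_iUnion₂.2 ⟨(U, W), hmem, ?_⟩
    refine h5.trans_le ?_
    have h6 := mul_le_mul_of_nonneg_left (hcard _ hmem)
      (show (0 : ℝ) ≤ T * p / 2 by positivity)
    simp only at h6
    linarith
  refine (measureReal_mono hsub (measure_ne_top μ _)).trans
    ((measureReal_biUnion_finset_le A B).trans ?_)
  have hterm : ∀ q ∈ A, μ.real (B q) ≤
      ((n : ℝ)⁻¹) ^ 2 * (((n : ℝ)⁻¹) ^ q.1.card * ((n : ℝ)⁻¹) ^ q.2.card) := by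
    intro q hq
    refine (measureReal_sum_binomial_lt_le D.measurable_count D.law_count D.indep_count
      (pairsBetween q.1 q.2ᶜ)).trans ?_
    rw [← pow_add, ← pow_add, ← exp_neg_mul_log_eq hn]
    refine Real.exp_le_exp.2 (neg_le_neg ?_)
    have h1 := hcard q hq
    rw [hA, Finset.mem_filter] at hq
    obtain ⟨-, -, h2, h3, -⟩ := hq
    have hk : (1 : ℝ) ≤ q.1.card := by exact_mod_cast h2.card_pos
    push_cast
    calc (2 + ((q.1.card : ℝ) + q.2.card)) * Real.log n
        ≤ ((3 + K) * q.1.card) * Real.log n := by gcongr; nlinarith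
      _ = ((3 + K) * Real.log n) * q.1.card := by ring
      _ ≤ (n * p / 16) * q.1.card := by gcongr
      _ = 1 * (p : ℝ) * (q.1.card * (n / 2)) / 8 := by ring
      _ ≤ T * p * (pairsBetween q.1 q.2ᶜ).card / 8 := by gcongr
  refine (Finset.sum_le_sum hterm).trans ?_
  refine (Finset.sum_le_sum_of_subset_of_nonneg (Finset.subset_univ A)
    fun q _ _ => by positivity).trans ?_
  rw [← Finset.mul_sum, Fintype.sum_prod_type]
  simp only
  rw [← Finset.sum_mul_sum, mul_comm, ← sq]
  have h := sum_pow_card_le_exp_one hn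
  have h0 : 0 ≤ ∑ U : Finset (Fin n), ((n : ℝ)⁻¹) ^ U.card :=
    Finset.sum_nonneg fun _ _ => by positivity
  gcongr

theorem IsDavidsonData.measureReal_large_noise_le (D : IsDavidsonData μ θ T p u N X) (hθ : 0 < θ)
    (hT : 1 ≤ T) (hn : 0 < n) {ε : ℝ} (hε0 : 0 ≤ ε) (hε : ε ≤ 1)
    (hεn : 3 * Real.log n ≤ ε ^ 2 * (n * p)) {s : ℝ} (hs : s = 1 ∨ s = -1) :
    μ.real {ω | ∃ U : Finset (Fin n), U.Nonempty ∧ ε * (T * p * n) * U.card ≤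
        s * cutNoise θ u U (fun e => N e ω) fun q => X q.1 q.2 ω} ≤
      Real.exp 1 * ((n : ℝ)⁻¹) ^ 2 := by
  classical
  set A : Finset (Finset (Fin n)) := Finset.univ.filter fun U => U.Nonempty with hA
  set B : Finset (Fin n) → Set Ω := fun U => {ω | ε * (T * p * n) * U.card ≤
    s * cutNoise θ u U (fun e => N e ω) fun q => X q.1 q.2 ω} with hB
  have hp0 := p.2.1
  have hT' : (1 : ℝ) ≤ T := by exact_mod_cast hT
  have hlog : 0 ≤ Real.log n := Real.log_natCast_nonneg n
  have hsub : {ω | ∃ U : Finset (Fin n), U.Nonempty ∧ ε * (T * p * n) * U.card ≤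
        s * cutNoise θ u U (fun e => N e ω) fun q => X q.1 q.2 ω} ⊆ ⋃ U ∈ A, B U := by
    rintro ω ⟨U, h1, h2⟩
    exact Set.mem_iUnion₂.2 ⟨U, by simpa [hA] using h1, h2⟩
  refine (measureReal_mono hsub (measure_ne_top μ _)).trans
    ((measureReal_biUnion_finset_le A B).trans ?_)
  have hterm : ∀ U ∈ A, μ.real (B U) ≤ ((n : ℝ)⁻¹) ^ 2 * ((n : ℝ)⁻¹) ^ U.card := by
    intro U hU
    refine (D.measureReal_cutNoise_ge_le hθ U hε0 hε hs).trans ?_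
    rw [← pow_add, ← exp_neg_mul_log_eq hn]
    refine Real.exp_le_exp.2 (neg_le_neg ?_)
    rw [hA, Finset.mem_filter] at hU
    have hk : (1 : ℝ) ≤ U.card := by exact_mod_cast hU.2.card_pos
    push_cast
    calc (2 + (U.card : ℝ)) * Real.log n ≤ (3 * U.card) * Real.log n := by gcongr; linarith
      _ = (3 * Real.log n) * U.card := by ring
      _ ≤ (ε ^ 2 * (n * p)) * U.card := by gcongr
      _ = ε ^ 2 * (1 * p * n) * U.card := by ring
      _ ≤ ε ^ 2 * (T * p * n) * U.card := by gcongr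
  refine (Finset.sum_le_sum hterm).trans ?_
  refine (Finset.sum_le_sum_of_subset_of_nonneg (Finset.subset_univ A)
    fun q _ _ => by positivity).trans ?_
  rw [← Finset.mul_sum, mul_comm]
  have h := sum_pow_card_le_exp_one hn
  gcongr

theorem IsDavidsonData.measureReal_not_regular_le (D : IsDavidsonData μ θ T p u N X) (hθ : 0 < θ)
    (hT : 1 ≤ T) (hn : 0 < n) {K ε : ℝ} (hK : (3 + K) * Real.log n ≤ n * p / 16)
    (hε0 : 0 ≤ ε) (hε : ε ≤ 1) (hεn : 3 * Real.log n ≤ ε ^ 2 * (n * p)) :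
    μ.real {ω | ¬ IsRegularData θ p u K ε (fun e => N e ω) fun e t => X e t ω} ≤
      14 / (n : ℝ) ^ 2 := by
  have hnull : μ.real {ω | ¬ ((∀ e, N e ω ≤ T) ∧ ∀ e t, X e t ω ∈ ({-1, 0, 1} : Set ℤ))} = 0 := by
    have h1 : ∀ᵐ ω ∂μ, (∀ e, N e ω ≤ T) ∧ ∀ e t, X e t ω ∈ ({-1, 0, 1} : Set ℤ) := by
      refine Eventually.and (eventually_all.2 fun e => ae_le_of_hasLaw_binomial (D.law_count e)) ?_
      exact eventually_all.2 fun e => eventually_all.2 fun t => D.ae_outcome_mem hθ e t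
    rw [measureReal_def, ae_iff.1 h1, ENNReal.toReal_zero]
  have hA := D.measureReal_not_expanding_le hT hn hK
  have hB := D.measureReal_large_noise_le hθ hT hn hε0 hε hεn (Or.inl rfl)
  have hC := D.measureReal_large_noise_le hθ hT hn hε0 hε hεn (Or.inr rfl)
  set E0 := {ω | ¬ ((∀ e, N e ω ≤ T) ∧ ∀ e t, X e t ω ∈ ({-1, 0, 1} : Set ℤ))}
  set E1 := {ω | ¬ IsExpanding (fun e => (N e ω : ℝ)) K (T * p * n / 4)}
  set E2 := {ω | ∃ U : Finset (Fin n), U.Nonempty ∧ ε * (T * p * n) * U.card ≤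
    1 * cutNoise θ u U (fun e => N e ω) fun q => X q.1 q.2 ω}
  set E3 := {ω | ∃ U : Finset (Fin n), U.Nonempty ∧ ε * (T * p * n) * U.card ≤
    -1 * cutNoise θ u U (fun e => N e ω) fun q => X q.1 q.2 ω}
  have hsub : {ω | ¬ IsRegularData θ p u K ε (fun e => N e ω) fun e t => X e t ω} ⊆
      (E0 ∪ E1) ∪ (E2 ∪ E3) := by
    intro ω hω
    by_contra hcon
    simp only [Set.mem_union, not_or] at hcon
    obtain ⟨⟨h0, h1⟩, h2, h3⟩ := hcon
    have h0' := not_not.1 h0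
    refine hω ⟨h0'.1, h0'.2, not_not.1 h1, fun U hU => abs_lt.2 ⟨?_, ?_⟩⟩
    · by_contra hc
      exact h3 ⟨U, hU, by linarith⟩
    · by_contra hc
      exact h2 ⟨U, hU, by linarith⟩
  have hle : μ.real {ω | ¬ IsRegularData θ p u K ε (fun e => N e ω) fun e t => X e t ω} ≤
      (μ.real E0 + μ.real E1) + (μ.real E2 + μ.real E3) :=
    (measureReal_mono hsub).trans ((measureReal_union_le _ _).trans
      (add_le_add (measureReal_union_le _ _) (measureReal_union_le _ _)))
  have he : Real.exp 1 ≤ 2.72 := by linarith [Real.exp_one_lt_d9]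
  have he0 := Real.exp_pos 1
  have hn2 : (0 : ℝ) ≤ ((n : ℝ)⁻¹) ^ 2 := by positivity
  rw [div_eq_mul_inv, ← inv_pow]
  -- One `e²` from expansion and one `e` for each sign of the noise.
  have hnum : Real.exp 1 ^ 2 + 2 * Real.exp 1 ≤ 14 := by nlinarith
  nlinarith [mul_le_mul_of_nonneg_right hnum hn2]

end Probability

/-! ### From regular data to the rate -/

theorem abs_relScore_le_dynamicRange {n : ℕ} (u : Fin n → ℝ) (e : SubjectPair n) :
    |relScore u e| ≤ dynamicRange u :=
  le_ciSup (f := fun q : Fin n × Fin n => |u q.1 - u q.2|) (Set.finite_range _).bddAbove e.1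

theorem dynamicRange_nonneg {n : ℕ} (u : Fin n → ℝ) : 0 ≤ dynamicRange u :=
  Real.iSup_nonneg fun _ => abs_nonneg _

theorem IsRegularData.existsUnique_isMLE {θ : ℝ} {T n : ℕ} {p : ℝ} {u : Fin n → ℝ} {K ε : ℝ}
    {ν : SubjectPair n → ℕ} {x : SubjectPair n → Fin T → ℤ}
    (R : IsRegularData θ p u K ε ν x) (hθ : 0 < θ) (hT : 1 ≤ T) (hn : 0 < n) (hp : 0 < p)
    (hu : u ∈ normalizedScores n) (hK : 1 ≤ K) (hε : 0 < ε) {m : ℕ} (hm : (n : ℝ) ≤ K ^ m)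
    {r : ℝ} (hr : 2 * m * (8 * ε * (2 + θ) ^ 2 * Real.exp (dynamicRange u + 1)) ≤ r)
    (hr1 : r < 1) :
    ∃ v : Fin n → ℝ, IsMLE θ ν x v ∧ (∀ w, IsMLE θ ν x w → w = v) ∧ ‖v - u‖ ≤ r := by
  obtain ⟨c, hc⟩ := logLikelihood_eq hθ R.count_le R.outcome_mem
  have hiff : ∀ v, IsMaxOn (logLikelihood θ ν x) (normalizedScores n) v ↔
      IsMaxOn (pairObjective θ (halfOutcomeSum ν x) fun e => (ν e : ℝ)) (normalizedScores n) v :=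
    fun v => by simp only [isMaxOn_iff, hc, add_le_add_iff_right]
  have hT' : (0 : ℝ) < T := by exact_mod_cast hT
  have hn' : (0 : ℝ) < n := by exact_mod_cast hn
  have hβ : 0 < T * p * n / 4 := by positivity
  have hb : ∀ U : Finset (Fin n), U.Nonempty → 2 * U.card ≤ n →
      |pairScore θ (halfOutcomeSum ν x) (fun e => (ν e : ℝ)) u (indicatorVec U)|
        ≤ ε * (T * p * n) * U.card := fun U hU _ => by
    have h := pairScore_eq_cutNoise (θ := θ) (u := u) R.count_le (fun q => x q.1 q.2) U
    simp only at h
    rw [h]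
    exact (R.noise_lt U hU).le
  obtain ⟨v, hv0, hv1, hv2, hv3⟩ := existsUnique_maximizer_of_isExpanding hθ hn
    (fun e => Nat.cast_nonneg _) hu (abs_relScore_le_dynamicRange u) R.expanding hβ hK hb
    -- With `β = T p n / 4` this makes `β * d` exactly twice the cut bound `γ`.
    (d := 8 * ε * (2 + θ) ^ 2 * Real.exp (dynamicRange u + 1)) (by positivity)
    (by
      rw [Real.exp_neg, div_div_eq_mul_div, div_inv_eq_mul]
      have : 0 < ε * (T * p * n) * (2 + θ) ^ 2 * Real.exp (dynamicRange u + 1) := by positivity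
      nlinarith)
    hm (hr.trans_lt hr1)
  exact ⟨v, ⟨hv0, (hiff v).2 hv1⟩, fun w hw => hv2 w hw.1 ((hiff w).1 hw.2), hv3.trans hr⟩

/-- A bound on `√(L / x) * (L / log x)` makes `L` negligible against `√x`. -/
theorem le_sqrt_of_rate_lt {L x : ℝ} (hL : 0 ≤ L) (hx : 1 < x)
    (h : √(L / x) * (L / Real.log x) ≤ 1 / 2048) : L ≤ √x / 64 := by
  set y := √(√x) with hy
  have hx0 : 0 < x := by linarith
  have hy0 : 0 < y := Real.sqrt_pos.2 (Real.sqrt_pos.2 hx0)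
  have hy2 : y ^ 2 = √x := Real.sq_sqrt (Real.sqrt_nonneg x)
  have hy4 : y ^ 4 = x := by
    rw [show y ^ 4 = (y ^ 2) ^ 2 by ring, hy2, Real.sq_sqrt hx0.le]
  have hlog : 0 < Real.log x := Real.log_pos hx
  have hlogle : Real.log x ≤ 4 * y := by
    rw [← hy4, Real.log_pow]
    push_cast
    linarith [Real.log_le_sub_one_of_pos hy0]
  have h1 : L / x * (L / Real.log x) ^ 2 ≤ (1 / 2048) ^ 2 := by
    have := pow_le_pow_left₀ (by positivity) h 2
    rwa [mul_pow, Real.sq_sqrt (by positivity)] at this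
  have h2 : L ^ 3 ≤ (1 / 2048) ^ 2 * (x * Real.log x ^ 2) := by
    rw [div_pow, div_mul_div_comm, div_le_iff₀ (by positivity)] at h1
    linarith
  have h3 : Real.log x ^ 2 ≤ (4 * y) ^ 2 := pow_le_pow_left₀ hlog.le hlogle 2
  -- Here `y = x^{1/4}`, and `log x ≤ 4 y` turns the squared hypothesis into `L³ ≤ 16 y⁶ / 2048²`;
  -- 2048 is chosen so that this equals `(y² / 64)³`.
  have h4 : L ^ 3 ≤ (y ^ 2 / 64) ^ 3 := by
    calc L ^ 3 ≤ (1 / 2048) ^ 2 * (x * (4 * y) ^ 2) := h2.trans (by gcongr)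
      _ = (y ^ 2 / 64) ^ 3 := by rw [← hy4]; ring
  rw [← hy2]
  exact le_of_pow_le_pow_left₀ (by norm_num) (by positivity) h4

section Main

variable {Ω : Type*} [MeasurableSpace Ω] {μ : Measure Ω} [IsProbabilityMeasure μ] {θ : ℝ}
  {T n : ℕ} {p : unitInterval} {u : Fin n → ℝ} {N : SubjectPair n → Ω → ℕ}
  {X : SubjectPair n → Fin T → Ω → ℤ}

theorem IsDavidsonData.measureReal_not_isMLE_near_le (D : IsDavidsonData μ θ T p u N X)
    (hθ : 0 < θ) (hT : 1 ≤ T) (hn : 3 ≤ n) (hu : u ∈ normalizedScores n) {c : ℝ} (hc : 1 < c)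
    (hp : c * (Real.log n / n) ≤ p)
    (h1 : davidsonRate n p (dynamicRange u) ≤ 1 / 2048)
    (h2 : 240 * (2 + θ) ^ 2 * davidsonRate n p (dynamicRange u) < 1) :
    μ.real {ω | ∃ v : Fin n → ℝ, IsMLE θ (fun e => N e ω) (fun e t => X e t ω) v ∧
      (∀ w, IsMLE θ (fun e => N e ω) (fun e t => X e t ω) w → w = v) ∧
      ‖v - u‖ ≤ 240 * (2 + θ) ^ 2 * davidsonRate n p (dynamicRange u)}ᶜ ≤ 14 / (n : ℝ) ^ 2 := by
  have hn0 : (0 : ℝ) < n := by exact_mod_cast (show 0 < n by omega)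
  set L := Real.log n with hL
  set x : ℝ := n * p with hx
  have hL1 : 1 < L := by
    rw [hL, Real.lt_log_iff_exp_lt hn0]
    have : (3 : ℝ) ≤ n := by exact_mod_cast hn
    linarith [Real.exp_one_lt_d9]
  have hxL : L < x := by
    have := mul_le_mul_of_nonneg_left hp hn0.le
    rw [show (n : ℝ) * (c * (L / n)) = c * L by field_simp] at this
    nlinarith
  have hx1 : 1 < x := hL1.trans hxL
  have hx0 : 0 < x := by linarith
  have hp0 : (0 : ℝ) < p := by
    by_contra hcon
    have := p.2.1
    have h0 : (p : ℝ) = 0 := le_antisymm (not_lt.1 hcon) this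
    rw [hx, h0, mul_zero] at hx0
    exact lt_irrefl _ hx0
  have hlx : 0 < Real.log x := Real.log_pos hx1
  have hlxL : Real.log x ≤ L := Real.log_le_log hx0 (by
    rw [hx]; exact mul_le_of_le_one_right hn0.le p.2.2)
  have hM := dynamicRange_nonneg u
  set Δ := davidsonRate n p (dynamicRange u) with hΔ
  have hΔ' : Δ = Real.exp (dynamicRange u) * √(L / x) * (L / Real.log x) := rfl
  have hq0 : 0 ≤ √(L / x) * (L / Real.log x) := by positivity
  have hrate : √(L / x) * (L / Real.log x) ≤ 1 / 2048 := by
    refine le_trans ?_ h1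
    rw [hΔ', mul_assoc]
    exact le_mul_of_one_le_left hq0 (Real.one_le_exp hM)
  have hLx := le_sqrt_of_rate_lt (by linarith) hx1 hrate
  have hs1 : 1 ≤ √x := Real.one_le_sqrt.2 hx1.le
  have hss : √x * √x = x := Real.mul_self_sqrt hx0.le
  have hLx2 : 3 * L ≤ x := by nlinarith
  set ε := √(3 * L / x) with hε
  have hε0 : 0 < ε := Real.sqrt_pos.2 (by positivity)
  have hε1 : ε ≤ 1 := Real.sqrt_le_one.2 ((div_le_one hx0).2 hLx2)
  have hε2 : ε ^ 2 = 3 * L / x := Real.sq_sqrt (by positivity)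
  -- The number of steps for which `(√x)^m ≥ n`. Rounding up is absorbed by passing from 2 to 3, as
  -- `L / log x ≥ 1`.
  set m := ⌈2 * L / Real.log x⌉₊ with hm
  have hm1 : 2 * L / Real.log x ≤ m := Nat.le_ceil _
  have hm2 : (m : ℝ) ≤ 3 * (L / Real.log x) := by
    have h3 := (Nat.ceil_lt_add_one (show 0 ≤ 2 * L / Real.log x by positivity)).le
    have h4 : 1 ≤ L / Real.log x := (one_le_div hlx).2 hlxL
    rw [← hm, mul_div_assoc] at h3
    linarith
  have hKm : (n : ℝ) ≤ √x ^ m := by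
    rw [← Real.log_le_log_iff hn0 (by positivity), Real.log_pow, Real.log_sqrt hx0.le]
    rw [div_le_iff₀ hlx] at hm1
    linarith
  have hr : 2 * m * (8 * ε * (2 + θ) ^ 2 * Real.exp (dynamicRange u + 1)) ≤
      240 * (2 + θ) ^ 2 * Δ := by
    have hε3 : ε ≤ 1.75 * √(L / x) := by
      rw [hε, mul_div_assoc, Real.sqrt_mul (by norm_num)]
      gcongr
      rw [Real.sqrt_le_left (by norm_num)]
      norm_num
    have he : Real.exp 1 ≤ 2.72 := by linarith [Real.exp_one_lt_d9]
    rw [Real.exp_add, hΔ']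
    calc 2 * m * (8 * ε * (2 + θ) ^ 2 * (Real.exp (dynamicRange u) * Real.exp 1))
        ≤ 2 * (3 * (L / Real.log x)) * (8 * (1.75 * √(L / x)) * (2 + θ) ^ 2 *
          (Real.exp (dynamicRange u) * 2.72)) := by gcongr
      _ = 228.48 * ((2 + θ) ^ 2 * (Real.exp (dynamicRange u) * √(L / x) *
          (L / Real.log x))) := by ring
      _ ≤ 240 * ((2 + θ) ^ 2 * (Real.exp (dynamicRange u) * √(L / x) *
          (L / Real.log x))) := by gcongr; norm_num
      _ = _ := by ring
  -- For `K = √x` the expansion condition follows from `3 + √x ≤ 4 √x` and `L ≤ √x / 64`.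
  refine (measureReal_mono ?_).trans (D.measureReal_not_regular_le (K := √x) (ε := ε) hθ hT
    (by omega) (by nlinarith) hε0.le hε1 (le_of_eq ?_))
  · intro ω hω hR
    exact hω (hR.existsUnique_isMLE hθ hT (by omega) hp0 hu hs1 hε0 hKm hr h2)
  · rw [hε2, div_mul_cancel₀ _ hx0.ne']

end Main

/-! ### Borel–Cantelli and the conclusion -/

theorem ae_eventually_mem_of_measureReal_compl_le {Ω : Type*} [MeasurableSpace Ω] {μ : Measure Ω}
    [IsFiniteMeasure μ] {E : ℕ → Set Ω} {a : ℝ}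
    (h : ∀ᶠ n : ℕ in atTop, μ.real (E n)ᶜ ≤ a / (n : ℝ) ^ 2) :
    ∀ᵐ ω ∂μ, ∀ᶠ n in atTop, ω ∈ E n := by
  obtain ⟨n₀, hn₀⟩ := eventually_atTop.1 h
  have hsum : Summable fun n : ℕ => a / ((n + n₀ : ℕ) : ℝ) ^ 2 := by
    have h1 : Summable fun n : ℕ => a / (n : ℝ) ^ 2 := by
      simpa [div_eq_mul_inv] using (Real.summable_nat_pow_inv.2 one_lt_two).mul_left a
    exact (summable_nat_add_iff n₀).2 h1
  have hne : ∑' n, μ (E (n + n₀))ᶜ ≠ ⊤ := by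
    refine ne_top_of_le_ne_top hsum.tsum_ofReal_ne_top (ENNReal.tsum_le_tsum fun n => ?_)
    rw [← ofReal_measureReal]
    exact ENNReal.ofReal_le_ofReal (hn₀ _ (by omega))
  filter_upwards [ae_eventually_notMem hne] with ω hω
  obtain ⟨n₁, hn₁⟩ := eventually_atTop.1 hω
  refine eventually_atTop.2 ⟨n₁ + n₀, fun n hn => ?_⟩
  have h1 := not_not.1 (hn₁ (n - n₀) (by omega))
  rwa [Nat.sub_add_cancel (by omega)] at h1

end

theorem mainTheorem9 (θ : ℝ) (hθ : 0 < θ) (T : ℕ) (hT : 1 ≤ T) :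
    ∃ C : ℝ, 0 < C ∧
      ∀ (Ω : Type*) [MeasurableSpace Ω] (μ : Measure Ω) [IsProbabilityMeasure μ]
        (p : ℕ → unitInterval) (u : (n : ℕ) → Fin n → ℝ)
        (N : (n : ℕ) → SubjectPair n → Ω → ℕ)
        (X : (n : ℕ) → SubjectPair n → Fin T → Ω → ℤ),
        (∀ n, u n ∈ normalizedScores n) →
        (∀ n, IsDavidsonData μ θ T (p n) (u n) (N n) (X n)) →
        (∃ c : ℝ, 1 < c ∧ ∀ᶠ n : ℕ in atTop, c * (Real.log n / n) ≤ p n) →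
        Tendsto (fun n : ℕ => davidsonRate n (p n) (dynamicRange (u n))) atTop (𝓝 0) →
        -- unique existence and uniform error bound with high probability
        (∀ᶠ n : ℕ in atTop,
          1 - 14 / (n : ℝ) ^ 2 ≤ μ.real {ω | ∃ v : Fin n → ℝ,
            IsMLE θ (fun e => N n e ω) (fun e t => X n e t ω) v ∧
            (∀ w, IsMLE θ (fun e => N n e ω) (fun e t => X n e t ω) w → w = v) ∧
            ‖v - u n‖ ≤ C * davidsonRate n (p n) (dynamicRange (u n))}) ∧
        -- almost surely, unique existence for all but finitely many `n`
        (∀ᵐ ω ∂μ, ∀ᶠ n : ℕ in atTop,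
          ∃! v : Fin n → ℝ, IsMLE θ (fun e => N n e ω) (fun e t => X n e t ω) v) ∧
        -- almost surely, convergence of the MLE in the supremum norm
        (∀ uhat : (n : ℕ) → Ω → Fin n → ℝ,
          (∀ n ω, (∃! v : Fin n → ℝ, IsMLE θ (fun e => N n e ω) (fun e t => X n e t ω) v) →
            IsMLE θ (fun e => N n e ω) (fun e t => X n e t ω) (uhat n ω)) →
          ∀ᵐ ω ∂μ, Tendsto (fun n => ‖uhat n ω - u n‖) atTop (𝓝 0)) := by
  refine ⟨240 * (2 + θ) ^ 2, by positivity, ?_⟩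
  intro Ω _ μ _ p u N X hu D hc hΔ
  obtain ⟨c, hc1, hc⟩ := hc
  set C := 240 * (2 + θ) ^ 2 with hC
  set E : ℕ → Set Ω := fun n => {ω | ∃ v : Fin n → ℝ,
    IsMLE θ (fun e => N n e ω) (fun e t => X n e t ω) v ∧
    (∀ w, IsMLE θ (fun e => N n e ω) (fun e t => X n e t ω) w → w = v) ∧
    ‖v - u n‖ ≤ C * davidsonRate n (p n) (dynamicRange (u n))} with hE
  have hCΔ : Tendsto (fun n : ℕ => C * davidsonRate n (p n) (dynamicRange (u n))) atTop (𝓝 0) := by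
    simpa using hΔ.const_mul C
  have hbad : ∀ᶠ n : ℕ in atTop, μ.real (E n)ᶜ ≤ 14 / (n : ℝ) ^ 2 := by
    filter_upwards [hc, eventually_ge_atTop 3, hΔ.eventually_le_const (show (0 : ℝ) < 1 / 2048 by
      norm_num), hCΔ.eventually_lt_const one_pos] with n h1 h2 h3 h4
    exact (D n).measureReal_not_isMLE_near_le hθ hT h2 (hu n) hc1 h1 h3 h4
  -- Summability of `14 / n²` suffices, so the joint law across different `n` plays no role.
  have hae : ∀ᵐ ω ∂μ, ∀ᶠ n in atTop, ω ∈ E n := ae_eventually_mem_of_measureReal_compl_le hbad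
  have hunique : ∀ n ω, ω ∈ E n →
      ∃! v : Fin n → ℝ, IsMLE θ (fun e => N n e ω) (fun e t => X n e t ω) v := by
    rintro n ω ⟨v, h1, h2, -⟩
    exact ⟨v, h1, h2⟩
  refine ⟨hbad.mono fun n hn => ?_, hae.mono fun ω hω => hω.mono fun n hn => hunique n ω hn,
    fun uhat huhat => ?_⟩
  · have h1 := measureReal_union_le (μ := μ) (E n) (E n)ᶜ
    rw [Set.union_compl_self, probReal_univ] at h1
    show _ ≤ μ.real (E n)
    linarith
  · filter_upwards [hae] with ω hω
    refine squeeze_zero' (Eventually.of_forall fun n => norm_nonneg _) (hω.mono fun n hn => ?_) hCΔ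
    have h1 := huhat n ω (hunique n ω hn)
    obtain ⟨v, -, h2, h3⟩ := hn
    rwa [h2 _ h1]
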